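/- Let $n\ge 2$ and let $M$ be one of the spaces $\mathbb{S}^n$ (the unit sphere), $\mathbb{E}^n$ (Euclidean space) or $\mathbb{H}^n$ (hyperbolic space of curvature $-1$), with its geodesic distance. For $U\subset M$, a closed geodesic ball $B\subset U$ (possibly of zero radius) is called maximal in $U$ if it is not a proper subset of another closed ball contained in $U$. The central set $C_U$ is the set of the centers of all maximal balls in $U$. For $X\subset C_U$, let $U_X$ be the union of all maximal balls in $U$ centered at points of $X$ (so $U_\varnothing=\varnothing$ and $C_\varnothing=\varnothing$). A ball-polytope is a set $U\subset M$ that is a union of finitely many closed balls of positive radii and whose boundary $\partial U$ is a piecewise smooth submanifold of codimension one, that is: $\partial U$, with the subspace topology, is a topological $(n-1)$-manifold, and every point of $\partial U$ has an open neighborhood $O$ in $M$ such that $\partial U\cap O$ is contained in the union of finitely many zero sets of smooth functions on $O$ whose differentials do not vanish on their zero sets. Lemma. Let $U\subset M$ be a ball-polytope, let $X\subset C_U$ be a non-empty set that is closed in $M$, and let $Z\subset X$ be the relative boundary of $X$ in $C_U$ (the topological boundary of $X$ as a subset of the subspace $C_U$). If $C_{U_Z}\subset X$, then $C_{U_X}=X$.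 -/

import Mathlib

open scoped Manifold ContDiff

noncomputable section

/-- The three types of geometry of constant curvature. -/
inductive Geom where
  | spherical
  | euclidean
  | hyperbolic

/-- A space in which a geodesic distance is named. -/
class GeodesicDist (M : Type) where
  /-- The geodesic distance. -/
  gdist : M → M → ℝ

/-- On the unit sphere the geodesic distance is the angle between unit vectors. -/
instance sphereGeodesicDist (n : ℕ) :
    GeodesicDist (Metric.sphere (0 : EuclideanSpace ℝ (Fin (n + 1))) 1) where
  gdist x y := InnerProductGeometry.angle
    (x : EuclideanSpace ℝ (Fin (n + 1))) (y : EuclideanSpace ℝ (Fin (n + 1)))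

/-- On `ℝⁿ` the geodesic distance is the Euclidean distance. -/
instance euclideanGeodesicDist (n : ℕ) : GeodesicDist (EuclideanSpace ℝ (Fin n)) where
  gdist x y := dist x y

/-- The open unit ball of `ℝⁿ`. -/
def unitBall (n : ℕ) : TopologicalSpace.Opens (EuclideanSpace ℝ (Fin n)) :=
  ⟨Metric.ball 0 1, Metric.isOpen_ball⟩

/-- The geodesic distance of curvature `-1` on the open unit ball (Poincaré ball model): the
number `d ≥ 0` with `sinh (d / 2) = ‖x - y‖ / √((1 - ‖x‖²) (1 - ‖y‖²))`, equivalently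
`cosh d = 1 + 2 ‖x - y‖² / ((1 - ‖x‖²) (1 - ‖y‖²))`. -/
instance hyperbolicGeodesicDist (n : ℕ) : GeodesicDist (unitBall n) where
  gdist x y := 2 * Real.arsinh
    (‖(x : EuclideanSpace ℝ (Fin n)) - (y : EuclideanSpace ℝ (Fin n))‖ /
      √((1 - ‖(x : EuclideanSpace ℝ (Fin n))‖ ^ 2) * (1 - ‖(y : EuclideanSpace ℝ (Fin n))‖ ^ 2)))

/-- The underlying manifold of the `n`-dimensional space of each geometry: the unit sphere of
`ℝⁿ⁺¹`, the space `ℝⁿ`, and the open unit ball of `ℝⁿ` (the Poincaré ball model). -/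
def ModelSpace (n : ℕ) : Geom → Type
  | .spherical => Metric.sphere (0 : EuclideanSpace ℝ (Fin (n + 1))) 1
  | .euclidean => EuclideanSpace ℝ (Fin n)
  | .hyperbolic => unitBall n

namespace ModelSpace

/-- The standard topology. -/
instance instTop (n : ℕ) : (g : Geom) → TopologicalSpace (ModelSpace n g)
  | .spherical =>
      inferInstanceAs
        (TopologicalSpace (Metric.sphere (0 : EuclideanSpace ℝ (Fin (n + 1))) 1))
  | .euclidean => inferInstanceAs (TopologicalSpace (EuclideanSpace ℝ (Fin n)))
  | .hyperbolic => inferInstanceAs (TopologicalSpace (unitBall n))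

/-- The standard smooth structure: Mathlib's stereographic atlas on the sphere, the identity
chart on `ℝⁿ`, and the inclusion into `ℝⁿ` on the open unit ball. -/
instance instCharted (n : ℕ) :
    (g : Geom) → ChartedSpace (EuclideanSpace ℝ (Fin n)) (ModelSpace n g)
  | .spherical =>
      inferInstanceAs (ChartedSpace (EuclideanSpace ℝ (Fin n))
        (Metric.sphere (0 : EuclideanSpace ℝ (Fin (n + 1))) 1))
  | .euclidean =>
      inferInstanceAs (ChartedSpace (EuclideanSpace ℝ (Fin n)) (EuclideanSpace ℝ (Fin n)))
  | .hyperbolic =>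
      inferInstanceAs (ChartedSpace (EuclideanSpace ℝ (Fin n)) (unitBall n))

/-- The geodesic distance. -/
instance instGeodesicDist (n : ℕ) : (g : Geom) → GeodesicDist (ModelSpace n g)
  | .spherical => sphereGeodesicDist n
  | .euclidean => euclideanGeodesicDist n
  | .hyperbolic => hyperbolicGeodesicDist n

end ModelSpace

namespace CentralSet

variable {M : Type} [GeodesicDist M]

/-- The closed geodesic ball of radius `r` about `x`. -/
def cball (x : M) (r : ℝ) : Set M := {y | GeodesicDist.gdist x y ≤ r}

/-- The closed ball of centre `x` and radius `r ≥ 0` (radius zero is allowed) is maximal in `U`: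
it lies in `U` and is not a proper subset of another closed ball that lies in `U`. -/
def IsMaximalBall (U : Set M) (x : M) (r : ℝ) : Prop :=
  0 ≤ r ∧ cball x r ⊆ U ∧
    ∀ (y : M) (s : ℝ), 0 ≤ s → cball y s ⊆ U → ¬ cball x r ⊂ cball y s

/-- The central set of `U`: the set of the centres of all maximal balls in `U`. -/
def centralSet (U : Set M) : Set M :=
  {x | ∃ r : ℝ, IsMaximalBall U x r}

/-- The set `U_X`: the union of all maximal balls in `U` that are centred at points of `X`. -/
def maximalBallUnion (U X : Set M) : Set M :=
  {p | ∃ x ∈ X, ∃ r : ℝ, IsMaximalBall U x r ∧ p ∈ cball x r}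

/-- The boundary of `X ∩ C` in the subspace `C`, as a subset of the whole space. -/
def relBoundary {M : Type} [TopologicalSpace M] (C X : Set M) : Set M :=
  ((↑) : C → M) '' frontier (((↑) : C → M) ⁻¹' X)

/-- `S` is a piecewise smooth submanifold of codimension one: with the subspace topology it is a
topological `(n - 1)`-manifold, and near each of its points it consists of finitely many pieces,
each lying in a smooth hypersurface (a regular zero set of a smooth function, hence closed in the
neighbourhood `O`). -/
def IsPiecewiseSmoothHypersurface (n : ℕ) {M : Type} [TopologicalSpace M]
    [ChartedSpace (EuclideanSpace ℝ (Fin n)) M] (S : Set M) : Prop :=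
  (∀ p : S, ∃ e : OpenPartialHomeomorph S (EuclideanSpace ℝ (Fin (n - 1))), p ∈ e.source) ∧
  ∀ p ∈ S, ∃ O : Set M, IsOpen O ∧ p ∈ O ∧
    ∃ (k : ℕ) (f : Fin k → M → ℝ),
      (∀ j, ContMDiffOn (𝓡 n) 𝓘(ℝ, ℝ) ∞ (f j) O ∧
        ∀ q ∈ O, f j q = 0 → mfderiv (𝓡 n) 𝓘(ℝ, ℝ) (f j) q ≠ 0) ∧
      ∀ q ∈ S ∩ O, ∃ j, f j q = 0

/-- A ball-polytope: a union of finitely many closed balls of positive radii whose boundary is a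
piecewise smooth submanifold of codimension one. -/
def IsBallPolytope (n : ℕ) [TopologicalSpace M] [ChartedSpace (EuclideanSpace ℝ (Fin n)) M]
    (U : Set M) : Prop :=
  (∃ (k : ℕ) (c : Fin k → M) (r : Fin k → ℝ),
    (∀ i, 0 < r i) ∧ U = ⋃ i, cball (c i) (r i)) ∧
  IsPiecewiseSmoothHypersurface n (frontier U)

end CentralSet

end

set_option linter.unusedSectionVars false

/-! In all three geometries a suitable chart carries geodesic balls to Euclidean balls: the
identity, the inclusion of the Poincaré ball, or stereographic projection from a point outside `U`.
Maximal balls of `U` become maximal Euclidean balls of the image `V`, and the geodesic centre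
depends continuously on the Euclidean ball. Only `U` equal to the whole sphere needs a separate
argument.

Let `B` be a maximal ball of `U_X`. It lies in a maximal ball of `U` with some centre `a`. If `a ∈
X`, the two balls coincide and the centre of `B` is in `X`. If `a ∉ X`, every interior point `p` of
`B` lies in the ball about `a` and in a maximal ball centred in `X`. The centres of the maximal
balls containing `p` form a connected set (`isPreconnected_centers`), so one of them lies in the
relative boundary `Z`. As `U_Z` is closed, `B ⊆ U_Z`; since `U_Z ⊆ U_X`, `B` is maximal in `U_Z`,
and the hypothesis puts its centre in `X`.

Connectedness comes from a star-shaped set: the `c` whose largest ball contains `p`. The largest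
ball about such a `c` lies in exactly one maximal ball, and this relation is closed, so a separation
of the maximal centres would separate the star-shaped set.

The closedness of the central set (`isClosed_maxCenters`) is where finiteness of the union of balls
matters. If a limit `x` of maximal centres were not maximal, its ball would touch the complement
only at one point `q`. Inversion about `q` turns the nearby complement into the far part of a
polyhedron. Convex duality then confines the maximal centres near `x` to a closed set that misses
`x`. -/

namespace BallUnion

open Metric Set Filter Topology
open scoped RealInnerProductSpace

/-! ### Largest balls, maximal centres and their connectedness -/

section Depth

variable {E : Type*} [NormedAddCommGroup E] [InnerProductSpace ℝ E]

/-- The distance from a point to the complement of `U`. -/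
noncomputable def depth (U : Set E) (x : E) : ℝ := infDist x Uᶜ

/-- The largest ball in `U` about `x` is contained in the largest ball in `U` about `y`. -/
def Below (U : Set E) (x y : E) : Prop := dist x y ≤ depth U y - depth U x

/-- The points of `U` whose largest ball lies in no other ball contained in `U`. -/
def maxCenters (U : Set E) : Set E := {x ∈ U | ∀ y, Below U x y → y = x}

variable {U : Set E}

lemma depth_nonneg (x : E) : 0 ≤ depth U x := infDist_nonneg

lemma continuous_depth : Continuous (depth U) := continuous_infDist_pt _

lemma depth_le_dist {x z : E} (hz : z ∈ closure Uᶜ) : depth U x ≤ dist x z := by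
  rw [depth, ← infDist_closure]
  exact infDist_le_dist_of_mem hz

lemma depth_eq_zero {x : E} (hx : x ∉ U) : depth U x = 0 := infDist_zero_of_mem hx

lemma mem_of_depth_pos {x : E} (hx : 0 < depth U x) : x ∈ U := by
  by_contra h
  exact hx.ne' (depth_eq_zero h)

lemma Below.refl (x : E) : Below U x x := by simp [Below]

lemma Below.trans {x y z : E} (hxy : Below U x y) (hyz : Below U y z) : Below U x z := by
  unfold Below at *
  linarith [dist_triangle x y z]

lemma Below.mem {x y : E} (hxy : Below U x y) (hx : x ∈ U) : y ∈ U := by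
  by_contra h
  have h0 := depth_eq_zero h
  unfold Below at hxy
  have h1 := depth_nonneg (U := U) x
  have : x = y := dist_le_zero.1 (by linarith)
  exact h (this ▸ hx)

lemma Below.closedBall_subset {x y : E} (hxy : Below U x y) {r : ℝ} (hr : r ≤ depth U x) :
    closedBall x r ⊆ closedBall y (depth U y) :=
  closedBall_subset_closedBall' (by unfold Below at hxy; linarith)

lemma closedBall_depth_subset (hU : IsClosed U) {x : E} (hx : x ∈ U) :
    closedBall x (depth U x) ⊆ U := by
  rcases eq_or_ne (depth U x) 0 with h | h
  · simpa [h] using hx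
  · rw [← closure_ball x h]
    exact closure_minimal ball_infDist_compl_subset hU

/-- The complement must be non-empty: `infDist` to the empty set is `0`, so `depth univ` vanishes.
-/
lemma le_depth (hne : Uᶜ.Nonempty) {x : E} {r : ℝ} (h : closedBall x r ⊆ U) : r ≤ depth U x := by
  by_contra hlt
  obtain ⟨z, hz, hd⟩ := (infDist_lt_iff hne).1 (not_le.1 hlt)
  exact hz (h (by rw [mem_closedBall, dist_comm]; exact hd.le))

lemma dist_le_sub_of_closedBall_subset [Nontrivial E] {x y : E} {r s : ℝ} (hr : 0 ≤ r)
    (h : closedBall x r ⊆ closedBall y s) : dist x y ≤ s - r := by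
  rcases eq_or_ne x y with rfl | hne
  · obtain ⟨z, hz⟩ := NormedSpace.sphere_nonempty (x := x) |>.2 hr
    have := mem_closedBall.1 (h (sphere_subset_closedBall hz))
    rw [mem_sphere.1 hz] at this
    simpa using this
  · have h0 : 0 < ‖x - y‖ := norm_pos_iff.2 (sub_ne_zero.2 hne)
    -- Test the inclusion on the point of the smaller ball farthest from `y`.
    have := h (show x + (r / ‖x - y‖) • (x - y) ∈ closedBall x r by
      rw [mem_closedBall, dist_eq_norm, add_sub_cancel_left, norm_smul, Real.norm_of_nonneg
        (by positivity), div_mul_cancel₀ _ h0.ne'])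
    rw [mem_closedBall, dist_eq_norm, show x + (r / ‖x - y‖) • (x - y) - y =
      (1 + r / ‖x - y‖) • (x - y) by module, norm_smul, Real.norm_of_nonneg (by positivity),
      add_mul, one_mul, div_mul_cancel₀ _ h0.ne'] at this
    rw [dist_eq_norm]
    linarith

lemma closedBall_injective [Nontrivial E] {x y : E} {r s : ℝ} (hr : 0 ≤ r) (hs : 0 ≤ s)
    (h : closedBall x r = closedBall y s) : x = y ∧ r = s := by
  have h1 := dist_le_sub_of_closedBall_subset hr h.subset
  have h2 := dist_le_sub_of_closedBall_subset hs h.symm.subset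
  rw [dist_comm] at h2
  have h3 := dist_nonneg (x := x) (y := y)
  exact ⟨dist_le_zero.1 (by linarith), by linarith⟩

variable [FiniteDimensional ℝ E]

lemma exists_nearest (hne : Uᶜ.Nonempty) (x : E) : ∃ q ∈ closure Uᶜ, dist x q = depth U x := by
  obtain ⟨q, hq, h⟩ := exists_mem_closure_infDist_eq_dist hne x
  exact ⟨q, hq, h.symm⟩

/-- Maximise `depth` over the compact set of points above `x`; anything above the maximiser has no
larger depth, hence distance zero from it. -/
lemma exists_below (hU : IsCompact U) {x : E} (hx : x ∈ U) :
    ∃ y ∈ maxCenters U, Below U x y := by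
  have hc : IsCompact {y | Below U x y} := by
    refine hU.of_isClosed_subset ?_ fun y hy => Below.mem hy hx
    exact isClosed_le (continuous_const.dist continuous_id) (continuous_depth.sub continuous_const)
  obtain ⟨y, hy, hmax⟩ := hc.exists_isMaxOn ⟨x, Below.refl x⟩ continuous_depth.continuousOn
  refine ⟨y, ⟨Below.mem hy hx, fun z hz => ?_⟩, hy⟩
  have h1 : depth U z ≤ depth U y := hmax (Below.trans hy hz)
  exact (dist_le_zero.1 (by unfold Below at hz; linarith)).symm

/-- Nested largest balls are internally tangent at every contact point `q` of the smaller one,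
because the triangle inequality through `x` is forced to be an equality. -/
lemma Below.wbtw {x y q : E} (h : Below U x y) (hq : q ∈ closure Uᶜ) (hd : dist x q = depth U x) :
    dist y q = depth U y ∧ Wbtw ℝ q x y := by
  have h1 := depth_le_dist (x := y) hq
  have h2 := dist_triangle y x q
  unfold Below at h
  rw [dist_comm y x] at h2
  refine ⟨by linarith, dist_add_dist_eq_iff.1 ?_⟩
  rw [dist_comm q x, dist_comm q y]
  linarith

lemma below_of_wbtw {x y q : E} (h : Wbtw ℝ q x y) (hx : dist x q = depth U x)
    (hy : dist y q = depth U y) : Below U x y := by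
  have := dist_add_dist_eq_iff.2 h
  rw [dist_comm q x, dist_comm q y] at this
  unfold Below
  linarith

/-- Both maximal centres lie on the ray from a contact point `q` through `x`, and of two centres on
that ray touching at `q` the nearer is below the farther. -/
lemma maxCenters_unique (hne : Uᶜ.Nonempty) {x y z : E} (hx : 0 < depth U x)
    (hy : y ∈ maxCenters U) (hz : z ∈ maxCenters U) (hxy : Below U x y) (hxz : Below U x z) :
    y = z := by
  obtain ⟨q, hq, hd⟩ := exists_nearest hne x
  obtain ⟨hyq, hwy⟩ := hxy.wbtw hq hd
  obtain ⟨hzq, hwz⟩ := hxz.wbtw hq hd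
  have hxq : x -ᵥ q ≠ 0 := by
    intro h
    rw [vsub_eq_zero_iff_eq.1 h, dist_self] at hd
    rw [vsub_eq_zero_iff_eq.1 h, ← hd] at hx
    exact hx.false
  have hs : SameRay ℝ (y -ᵥ q) (z -ᵥ q) :=
    hwy.sameRay_vsub_left.symm.trans hwz.sameRay_vsub_left fun h => (hxq h).elim
  rcases wbtw_total_of_sameRay_vsub_left hs with h | h
  · exact (hy.2 z (below_of_wbtw h hyq hzq)).symm
  · exact hz.2 y (below_of_wbtw h hzq hyq)

/-- The centres of the maximal balls that contain a given interior point form a connected set. -/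
theorem isPreconnected_centers (hU : IsCompact U) (hne : Uᶜ.Nonempty)
    (hC : IsClosed (maxCenters U)) {p : E} (hp : 0 < depth U p) :
    IsPreconnected {a ∈ maxCenters U | p ∈ closedBall a (depth U a)} := by
  set K : Set E := {a ∈ maxCenters U | p ∈ closedBall a (depth U a)} with hK
  have hKc : IsClosed K :=
    hC.inter (isClosed_le (continuous_const.dist continuous_id) continuous_depth)
  set S : Set E := {c | dist p c ≤ depth U c} with hS
  have hpos : ∀ c ∈ S, 0 < depth U c := by
    intro c hc
    refine (depth_nonneg c).lt_of_ne fun h => ?_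
    have : p = c := dist_le_zero.1 (by rw [h]; exact hc)
    exact hp.ne (this ▸ h)
  have hSc : IsCompact S := hU.of_isClosed_subset
    (isClosed_le (continuous_const.dist continuous_id) continuous_depth)
    fun c hc => mem_of_depth_pos (hpos c hc)
  have hSp : IsPreconnected S := by
    have hstar : StarConvex ℝ p S := by
      refine starConvex_iff_forall_pos (by simp [hS, depth_nonneg]) |>.2 ?_
      intro c hc a b ha hb hab
      have h1 : depth U c ≤ depth U (a • p + b • c) + dist c (a • p + b • c) :=
        infDist_le_infDist_add_dist
      have h2 : dist c (a • p + b • c) = a * dist p c := by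
        rw [dist_eq_norm, show c - (a • p + b • c) = a • (c - p) by
          rw [show b = 1 - a by linarith]; module, norm_smul, Real.norm_of_nonneg ha.le,
          dist_comm, dist_eq_norm]
      have h3 : dist p (a • p + b • c) = b * dist p c := by
        rw [dist_eq_norm, show p - (a • p + b • c) = b • (p - c) by
          rw [show a = 1 - b by linarith]; module, norm_smul, Real.norm_of_nonneg hb.le,
          dist_eq_norm]
      change dist p _ ≤ _
      have h4 : a * dist p c + b * dist p c = dist p c := by rw [← add_mul, hab, one_mul]
      have h5 : dist p c ≤ depth U c := hc
      linarith
    exact (hstar.isPathConnected (by simp [hS, depth_nonneg])).isConnected.isPreconnected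
  have hKS : K ⊆ S := fun a ha => ha.2
  have hup : ∀ c ∈ S, ∀ a ∈ maxCenters U, Below U c a → a ∈ K := fun c hc a ha hca =>
    ⟨ha, hca.closedBall_subset le_rfl hc⟩
  -- This set is the projection of a compact part of the closed relation `Below`.
  have hproj : ∀ t : Set E, IsClosed t → IsClosed {c ∈ S | ∃ a ∈ K ∩ t, Below U c a} := by
    intro t ht
    have hcomp : IsCompact ((S ×ˢ (K ∩ t)) ∩ {z : E × E | Below U z.1 z.2}) := by
      refine (hSc.prod (hSc.of_isClosed_subset (hKc.inter ht)
        (inter_subset_left.trans hKS))).inter_right ?_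
      exact isClosed_le (continuous_fst.dist continuous_snd)
        ((continuous_depth.comp continuous_snd).sub (continuous_depth.comp continuous_fst))
    convert (hcomp.image continuous_fst).isClosed using 1
    ext c
    constructor
    · rintro ⟨hc, a, ha, hca⟩
      exact ⟨(c, a), ⟨⟨hc, ha⟩, hca⟩, rfl⟩
    · rintro ⟨⟨c, a⟩, ⟨⟨hc, ha⟩, hca⟩, rfl⟩
      exact ⟨hc, a, ha, hca⟩
  rw [isPreconnected_closed_iff]
  rintro t t' ht ht' hcov ⟨a, haK, hat⟩ ⟨a', haK', hat'⟩
  -- The closed cover of `K` pulls back to a closed cover of the connected set `S`; at a common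
  -- point `c` the two maximal centres above it agree by uniqueness.
  obtain ⟨c, hcS, ⟨-, b, hb, hcb⟩, ⟨-, b', hb', hcb'⟩⟩ :=
    isPreconnected_closed_iff.1 hSp _ _ (hproj t ht) (hproj t' ht')
      (fun c hc => by
        obtain ⟨a, ha, hca⟩ := exists_below hU (mem_of_depth_pos (hpos c hc))
        have haK := hup c hc a ha hca
        rcases hcov haK with h | h
        · exact Or.inl ⟨hc, a, ⟨haK, h⟩, hca⟩
        · exact Or.inr ⟨hc, a, ⟨haK, h⟩, hca⟩)
      ⟨a, hKS haK, hKS haK, a, ⟨haK, hat⟩, Below.refl a⟩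
      ⟨a', hKS haK', hKS haK', a', ⟨haK', hat'⟩, Below.refl a'⟩
  have := maxCenters_unique hne (hpos c hcS) hb.1.1 hb'.1.1 hcb hcb'
  exact ⟨b, hb.1, hb.2, this ▸ hb'.2⟩

end Depth

end BallUnion

namespace BallUnion

open Metric Set Filter Topology
open scoped RealInnerProductSpace

/-! ### Linear and quadratic functions on the far part of a polyhedron -/

section Polyhedron

variable {E : Type*} [NormedAddCommGroup E] [InnerProductSpace ℝ E] {ι : Type*}

/-- The open polyhedron `{w | 2⟪w, γ i⟫ < 1 for i ∈ I}`. -/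
def polyhedron (I : Set ι) (γ : ι → E) : Set E := {w | ∀ i ∈ I, 2 * ⟪w, γ i⟫ < 1}

variable {I : Set ι} {γ : ι → E}

lemma add_smul_sub_mem_polyhedron {w w' : E} (hw' : ∀ i ∈ I, 2 * ⟪w', γ i⟫ ≤ 1)
    (hw : w ∈ polyhedron I γ) {s : ℝ} (hs0 : 0 < s) (hs1 : s ≤ 1) :
    w' + s • (w - w') ∈ polyhedron I γ := by
  intro i hi
  have h1 := hw' i hi
  have h2 := hw i hi
  rw [inner_add_left, inner_smul_left, inner_sub_left]
  simp only [conj_trivial]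
  nlinarith

/-- The convex combinations of the `γ j` over those sets `J` of indices whose constraints are
simultaneously almost attained by points of the polyhedron of norm more than `R`. -/
def unboundedFaces [Fintype ι] (I : Set ι) (γ : ι → E) (R : ℝ) : Set E :=
  ⋃ J ∈ {J : Set ι | ∀ δ > 0, ∃ w ∈ polyhedron I γ, R < ‖w‖ ∧ ∀ j ∈ J, 1 - δ < 2 * ⟪w, γ j⟫},
    (fun l : ι → ℝ => ∑ i, l i • γ i) '' {l ∈ stdSimplex ℝ ι | ∀ i ∉ J, l i = 0}

variable [Fintype ι]

lemma isClosed_unboundedFaces (R : ℝ) : IsClosed (unboundedFaces I γ R) := by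
  refine (Set.toFinite _).isClosed_biUnion fun J _ => ?_
  have hc : IsClosed {l : ι → ℝ | ∀ i ∉ J, l i = 0} := by
    simp only [ofPred_forall]
    exact isClosed_iInter fun i => isClosed_iInter fun _ =>
      isClosed_eq (continuous_apply i) continuous_const
  exact (((isCompact_stdSimplex ℝ ι).inter_right hc).image (by fun_prop)).isClosed

lemma notMem_unboundedFaces {R t : ℝ} {ξ : E} (ht : t < 1)
    (h : ∀ w ∈ polyhedron I γ, R < ‖w‖ → 2 * ⟪w, ξ⟫ ≤ t) : ξ ∉ unboundedFaces I γ R := by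
  intro hξ
  simp only [unboundedFaces, mem_iUnion] at hξ
  obtain ⟨J, hJ, l, ⟨⟨hl0, hl1⟩, hlJ⟩, rfl⟩ := hξ
  obtain ⟨w, hw, hR, hwJ⟩ := hJ (1 - t) (by linarith)
  have h1 := h w hw hR
  have h2 : t < ∑ i, l i * (2 * ⟪w, γ i⟫) := by
    rw [show t = ∑ i, l i * t by rw [← Finset.sum_mul, hl1, one_mul]]
    have hle : ∀ i ∈ Finset.univ, l i * t ≤ l i * (2 * ⟪w, γ i⟫) := by
      intro i _
      by_cases hi : i ∈ J
      · have := hwJ i hi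
        exact mul_le_mul_of_nonneg_left (by linarith) (hl0 i)
      · simp [hlJ i hi]
    refine Finset.sum_lt_sum hle ?_
    obtain ⟨i, -, hi⟩ := Finset.exists_ne_zero_of_sum_ne_zero (hl1.trans_ne one_ne_zero)
    have hiJ : i ∈ J := by
      by_contra hc
      exact hi (hlJ i hc)
    refine ⟨i, Finset.mem_univ _, ?_⟩
    have := hwJ i hiJ
    exact mul_lt_mul_of_pos_left (by linarith) ((hl0 i).lt_of_ne' hi)
  rw [inner_sum, Finset.mul_sum] at h1
  simp only [inner_smul_right] at h1
  refine h2.not_ge (le_of_eq_of_le (Finset.sum_congr rfl fun i _ => ?_) h1)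
  ring

/-- If the functional exceeded `1` at some `v`, moving slightly towards `v` from a far point where
it is nearly `1` would give a far point where it exceeds `1`. -/
lemma inner_le_of_unbounded {R : ℝ} (hR : 0 ≤ R) {ξ : E}
    (h1 : ∀ w ∈ polyhedron I γ, R < ‖w‖ → 2 * ⟪w, ξ⟫ ≤ 1)
    (h2 : ∀ δ > 0, ∃ w ∈ polyhedron I γ, R + 1 < ‖w‖ ∧ 1 - δ < 2 * ⟪w, ξ⟫) :
    ∀ w ∈ polyhedron I γ, 2 * ⟪w, ξ⟫ ≤ 1 := by
  intro v hv
  by_contra! hlt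
  set κ := 2 * ⟪v, ξ⟫ - 1 with hκ
  have hκ0 : 0 < κ := by linarith
  -- With this `s` the moved point has norm above `(1 - s)(R + 1) - s‖v‖ = R + s`, and the choice `δ
  -- = s κ` below makes the functional exceed `1 + s²κ`.
  set s : ℝ := (R + 2 + ‖v‖)⁻¹ with hs
  have hden : 0 < R + 2 + ‖v‖ := by positivity
  have hs0 : 0 < s := by positivity
  have hsd : s * (R + 2 + ‖v‖) = 1 := inv_mul_cancel₀ hden.ne'
  have hs1 : s < 1 := by nlinarith [norm_nonneg v]
  obtain ⟨w, hw, hwR, hwξ⟩ := h2 (s * κ) (by positivity)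
  have hmem := add_smul_sub_mem_polyhedron (fun i hi => (hw i hi).le) hv hs0 hs1.le
  have hnorm : R < ‖w + s • (v - w)‖ := by
    have h3 : (1 - s) * ‖w‖ ≤ ‖w + s • (v - w)‖ + s * ‖v‖ := by
      have := norm_sub_le (w + s • (v - w)) (s • v)
      rw [show w + s • (v - w) - s • v = (1 - s) • w by module, norm_smul, norm_smul,
        Real.norm_of_nonneg hs0.le, Real.norm_of_nonneg (by linarith)] at this
      exact this
    nlinarith [norm_nonneg v]
  have h4 := h1 _ hmem hnorm
  rw [inner_add_left, inner_smul_left, inner_sub_left] at h4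
  simp only [conj_trivial] at h4
  have h5 := mul_lt_mul_of_pos_left hwξ (show 0 < 1 - s by linarith)
  have h6 : 0 < s * s * κ := by positivity
  rw [hκ] at h5 h6
  nlinarith

/-- By Farkas duality, a functional bounded by `1` on the polyhedron is a non-negative combination
of the constraints with total weight at most `1`. Near-attainment far away forces total weight `1`
and makes every constraint of positive weight nearly tight at the same points. -/
lemma mem_unboundedFaces [FiniteDimensional ℝ E] {R : ℝ} (hR : 0 ≤ R) {ξ : E}
    (h1 : ∀ w ∈ polyhedron I γ, R < ‖w‖ → 2 * ⟪w, ξ⟫ ≤ 1)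
    (h2 : ∀ δ > 0, ∃ w ∈ polyhedron I γ, R + 1 < ‖w‖ ∧ 1 - δ < 2 * ⟪w, ξ⟫) :
    ξ ∈ unboundedFaces I γ R := by
  classical
  have h3 := inner_le_of_unbounded hR h1 h2
  set L : Set (ι → ℝ) := {l | (∀ i, 0 ≤ l i) ∧ ∑ i, l i ≤ 1 ∧ ∀ i ∉ I, l i = 0} with hL
  have hLcl : IsClosed L := by
    refine IsClosed.and ?_ (IsClosed.and ?_ ?_)
    · simp only [ofPred_forall]
      exact isClosed_iInter fun i => isClosed_le continuous_const (continuous_apply i)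
    · exact isClosed_le (by fun_prop) continuous_const
    · simp only [ofPred_forall]
      exact isClosed_iInter fun i => isClosed_iInter fun _ =>
        isClosed_eq (continuous_apply i) continuous_const
  have hLc : IsCompact L := by
    refine (isCompact_Icc (a := (0 : ι → ℝ)) (b := 1)).of_isClosed_subset hLcl ?_
    intro l hl
    refine ⟨fun i => hl.1 i, fun i => ?_⟩
    exact (Finset.single_le_sum (fun j _ => hl.1 j) (Finset.mem_univ i)).trans hl.2.1
  have hLconv : Convex ℝ L := by
    intro l hl m hm a b ha hb hab
    refine ⟨fun i => ?_, ?_, fun i hi => ?_⟩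
    · have := hl.1 i
      have := hm.1 i
      simp only [Pi.add_apply, Pi.smul_apply, smul_eq_mul]
      positivity
    · simp only [Pi.add_apply, Pi.smul_apply, smul_eq_mul, Finset.sum_add_distrib,
        ← Finset.mul_sum]
      nlinarith [hl.2.1, hm.2.1]
    · simp [hl.2.2 i hi, hm.2.2 i hi]
  have hmem : ξ ∈ Fintype.linearCombination ℝ γ '' L := by
    by_contra hnot
    have hcl : IsClosed (Fintype.linearCombination ℝ γ '' L) :=
      (hLc.image (LinearMap.continuous_of_finiteDimensional _)).isClosed
    obtain ⟨f, u, hfu, hfξ⟩ := geometric_hahn_banach_closed_point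
      (hLconv.linear_image _) hcl hnot
    have hu : 0 < u := by
      have := hfu 0 ⟨0, by simp [hL], by simp⟩
      simpa using this
    -- The separating functional, rescaled by `(2 * u)⁻¹`, is a point of the polyhedron at which `ξ`
    -- violates the bound `h3`.
    set v := (InnerProductSpace.toDual ℝ E).symm f with hv
    have hvf : ∀ y, ⟪v, y⟫ = f y := fun y => InnerProductSpace.toDual_symm_apply
    have hin : ∀ y, 2 * ⟪(2 * u)⁻¹ • v, y⟫ = f y / u := by
      intro y
      rw [inner_smul_left, hvf]
      simp only [conj_trivial]
      field_simp
    have hvP : (2 * u)⁻¹ • v ∈ polyhedron I γ := by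
      intro i hi
      rw [hin, div_lt_one hu]
      refine hfu _ ⟨Pi.single i 1, ⟨fun j => ?_, by simp, fun j hj => ?_⟩, by
        simp [Fintype.linearCombination_apply_single]⟩
      · rw [Pi.single_apply]
        split_ifs <;> norm_num
      · rw [Pi.single_eq_of_ne]
        rintro rfl
        exact hj hi
    have h4 := h3 _ hvP
    rw [hin, div_le_one hu] at h4
    linarith
  obtain ⟨l, ⟨hl0, hl1, hl⟩, rfl⟩ := hmem
  have hexp : ∀ w, 2 * ⟪w, Fintype.linearCombination ℝ γ l⟫ = ∑ i, l i * (2 * ⟪w, γ i⟫) := by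
    intro w
    rw [Fintype.linearCombination_apply, inner_sum, Finset.mul_sum]
    refine Finset.sum_congr rfl fun i _ => ?_
    rw [inner_smul_right]
    ring
  have hlI : ∀ i, l i ≠ 0 → i ∈ I := by
    intro i hi
    by_contra hc
    exact hi (hl i hc)
  have hkey : ∀ w ∈ polyhedron I γ, ∀ i, l i * (2 * ⟪w, γ i⟫) ≤ l i := by
    intro w hw i
    by_cases hi : l i = 0
    · simp [hi]
    · have := hw i (hlI i hi)
      exact mul_le_of_le_one_right (hl0 i) this.le
  have hsum : ∑ i, l i = 1 := by
    refine le_antisymm hl1 (le_of_forall_sub_le fun δ hδ => ?_)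
    obtain ⟨w, hw, -, hwδ⟩ := h2 δ hδ
    rw [hexp] at hwδ
    exact hwδ.le.trans (Finset.sum_le_sum fun i _ => hkey w hw i)
  simp only [unboundedFaces, mem_iUnion]
  refine ⟨{i | l i ≠ 0}, fun δ hδ => ?_, l, ⟨⟨hl0, hsum⟩, fun i hi => by simpa using hi⟩, rfl⟩
  -- A total defect below `m * δ` leaves each constraint of weight at least `m` with defect below
  -- `δ`.
  obtain ⟨m, hm0, hm⟩ : ∃ m > 0, ∀ i, l i ≠ 0 → m ≤ l i := by
    have hne : ∃ i, l i ≠ 0 := by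
      by_contra! hc
      simp [hc] at hsum
    obtain ⟨i, hi, hmin⟩ := (Set.toFinite {i | l i ≠ 0}).exists_minimalFor l _ hne
    refine ⟨l i, (hl0 i).lt_of_ne' hi, fun j hj => ?_⟩
    rcases le_total (l i) (l j) with h | h
    · exact h
    · exact hmin hj h
  obtain ⟨w, hw, hwR, hwδ⟩ := h2 (m * δ) (by positivity)
  refine ⟨w, hw, by linarith, fun j hj => ?_⟩
  rw [hexp] at hwδ
  have h5 : ∑ i, l i * (2 * ⟪w, γ i⟫) ≤ 1 - l j + l j * (2 * ⟪w, γ j⟫) := by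
    rw [← hsum, ← Finset.add_sum_erase _ _ (Finset.mem_univ j),
      ← Finset.add_sum_erase _ l (Finset.mem_univ j)]
    have := Finset.sum_le_sum (s := Finset.univ.erase j) fun i _ => hkey w hw i
    linarith
  have h6 : m ≤ l j := hm j hj
  by_contra! hc
  have h7 : m * δ ≤ l j * δ := by gcongr
  have h8 : 0 < l j := by linarith
  nlinarith

/-- First-order condition: a quadratic function that is non-negative far out on a polyhedron and
vanishes at a boundary point grows quadratically. -/
lemma quadratic_growth {R e : ℝ} {ξ w' : E} (hw' : ∀ i ∈ I, 2 * ⟪w', γ i⟫ ≤ 1) (hR : R < ‖w'‖)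
    (hg : ∀ w ∈ polyhedron I γ, R < ‖w‖ → 0 ≤ 1 - 2 * ⟪w, ξ⟫ + e * ‖w‖ ^ 2)
    (h0 : 1 - 2 * ⟪w', ξ⟫ + e * ‖w'‖ ^ 2 = 0) {w : E} (hw : w ∈ polyhedron I γ) :
    e * ‖w - w'‖ ^ 2 ≤ 1 - 2 * ⟪w, ξ⟫ + e * ‖w‖ ^ 2 := by
  set d : ℝ := -2 * ⟪w - w', ξ⟫ + 2 * e * ⟪w', w - w'⟫ with hd
  have hexp : ∀ s : ℝ, 1 - 2 * ⟪w' + s • (w - w'), ξ⟫ + e * ‖w' + s • (w - w')‖ ^ 2 =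
      s * d + s ^ 2 * (e * ‖w - w'‖ ^ 2) := by
    intro s
    rw [norm_add_sq_real, inner_add_left, inner_smul_left, inner_smul_right, norm_smul, mul_pow,
      Real.norm_eq_abs, sq_abs, hd]
    simp only [conj_trivial]
    linear_combination h0
  have hd0 : 0 ≤ d := by
    -- For small `s` the segment from `w'` to `w` stays in the far region, so the derivative `d` at
    -- `w'` cannot be negative.
    have hev : ∀ᶠ s : ℝ in 𝓝[>] 0, 0 ≤ d + s * (e * ‖w - w'‖ ^ 2) := by
      have hcont : ContinuousAt (fun s : ℝ => ‖w' + s • (w - w')‖) 0 := by fun_prop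
      have hlt : ∀ᶠ s : ℝ in 𝓝 0, R < ‖w' + s • (w - w')‖ :=
        hcont.eventually (lt_mem_nhds (by simpa using hR))
      filter_upwards [self_mem_nhdsWithin, nhdsWithin_le_nhds hlt,
        nhdsWithin_le_nhds (Iio_mem_nhds one_pos)] with s hs0 hs hs1
      have := hg _ (add_smul_sub_mem_polyhedron hw' hw hs0 (le_of_lt hs1)) hs
      rw [hexp] at this
      have hs0' : (0 : ℝ) < s := hs0
      have h' : 0 ≤ s * (d + s * (e * ‖w - w'‖ ^ 2)) := by linarith
      exact nonneg_of_mul_nonneg_right h' hs0'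
    have ht : Tendsto (fun s : ℝ => d + s * (e * ‖w - w'‖ ^ 2)) (𝓝[>] 0)
        (𝓝 (d + 0 * (e * ‖w - w'‖ ^ 2))) :=
      Tendsto.mono_left (Continuous.tendsto (by fun_prop) 0) nhdsWithin_le_nhds
    have := ge_of_tendsto ht hev
    simpa using this
  have := hexp 1
  rw [one_smul, add_sub_cancel] at this
  rw [this]
  linarith

end Polyhedron

end BallUnion

namespace BallUnion

open Metric Set Filter Topology
open scoped RealInnerProductSpace

/-! ### Inversion in the unit sphere -/

section Inversion

variable {E : Type*} [NormedAddCommGroup E] [InnerProductSpace ℝ E]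

/-- Inversion in the unit sphere about the origin. -/
noncomputable def unitInv (w : E) : E := (‖w‖ ^ 2)⁻¹ • w

lemma norm_unitInv (w : E) : ‖unitInv w‖ = ‖w‖⁻¹ := by
  rcases eq_or_ne w 0 with rfl | h
  · simp [unitInv]
  · have : ‖w‖ ≠ 0 := norm_ne_zero_iff.2 h
    rw [unitInv, norm_smul, norm_inv, norm_pow, norm_norm]
    field_simp

lemma unitInv_unitInv (w : E) : unitInv (unitInv w) = w := by
  rcases eq_or_ne w 0 with rfl | h
  · simp [unitInv]
  · have : ‖w‖ ≠ 0 := norm_ne_zero_iff.2 h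
    rw [unitInv, norm_unitInv, unitInv, smul_smul]
    field_simp
    simp

lemma norm_sq_mul_norm_unitInv_sub_sq {w : E} (hw : w ≠ 0) (ξ : E) :
    ‖w‖ ^ 2 * ‖unitInv w - ξ‖ ^ 2 = 1 - 2 * ⟪w, ξ⟫ + ‖w‖ ^ 2 * ‖ξ‖ ^ 2 := by
  have : ‖w‖ ≠ 0 := norm_ne_zero_iff.2 hw
  rw [norm_sub_sq_real, norm_unitInv, unitInv, inner_smul_left]
  simp only [conj_trivial]
  field_simp

lemma norm_unitInv_sub_unitInv_sq {w w' : E} (hw : w ≠ 0) (hw' : w' ≠ 0) :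
    ‖w‖ ^ 2 * ‖w'‖ ^ 2 * ‖unitInv w - unitInv w'‖ ^ 2 = ‖w - w'‖ ^ 2 := by
  have h' : ‖w'‖ ≠ 0 := norm_ne_zero_iff.2 hw'
  rw [mul_right_comm, norm_sq_mul_norm_unitInv_sub_sq hw, norm_unitInv, norm_sub_sq_real, unitInv,
    inner_smul_right]
  field_simp
  ring

lemma lt_norm_unitInv_sub_iff {w γ : E} (hw : w ≠ 0) : ‖γ‖ < ‖unitInv w - γ‖ ↔ 2 * ⟪w, γ⟫ < 1 := by
  have h : 0 < ‖w‖ ^ 2 := by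
    have := norm_pos_iff.2 hw
    positivity
  rw [← sq_lt_sq₀ (norm_nonneg _) (norm_nonneg _), ← mul_lt_mul_iff_right₀ h,
    norm_sq_mul_norm_unitInv_sub_sq hw]
  constructor <;> intro <;> linarith

lemma le_norm_unitInv_sub_iff {w γ : E} (hw : w ≠ 0) : ‖γ‖ ≤ ‖unitInv w - γ‖ ↔ 2 * ⟪w, γ⟫ ≤ 1 := by
  have h : 0 < ‖w‖ ^ 2 := by
    have := norm_pos_iff.2 hw
    positivity
  rw [← sq_le_sq₀ (norm_nonneg _) (norm_nonneg _), ← mul_le_mul_iff_right₀ h,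
    norm_sq_mul_norm_unitInv_sub_sq hw]
  constructor <;> intro <;> linarith

end Inversion

/-! ### Closedness of the central set -/

section Closedness

variable {E : Type*} [NormedAddCommGroup E] [InnerProductSpace ℝ E]

lemma norm_sub_smul_sq {a b : E} {t : ℝ} (ht : 0 ≤ t) (h : ‖b‖ ≤ ‖a - b‖) :
    ‖t • b‖ ^ 2 + (1 - t) * ‖a‖ ^ 2 ≤ ‖a - t • b‖ ^ 2 := by
  have h1 : ‖b‖ ^ 2 ≤ ‖a - b‖ ^ 2 := by gcongr
  rw [norm_sub_sq_real] at h1 ⊢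
  rw [inner_smul_right]
  nlinarith

/-- Compares the power of `z` with respect to the ball about `x` through `q` and to its dilation
from `q` by the factor `1 + ε`. -/
lemma norm_sub_add_smul_sq (z x q : E) (ε : ℝ) :
    ‖z - (x + ε • (x - q))‖ ^ 2 - (1 + ε) ^ 2 * ‖x - q‖ ^ 2 =
      (1 + ε) * (‖z - x‖ ^ 2 - ‖x - q‖ ^ 2) - ε * ‖z - q‖ ^ 2 := by
  obtain ⟨a, rfl⟩ : ∃ a, z = q + a := ⟨z - q, by abel⟩
  obtain ⟨b, rfl⟩ : ∃ b, x = q + b := ⟨x - q, by abel⟩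
  have h1 : q + a - (q + b + ε • b) = a - (1 + ε) • b := by module
  rw [add_sub_cancel_left, add_sub_cancel_left, h1, add_sub_add_left_eq_sub, norm_sub_sq_real,
    norm_sub_sq_real, inner_smul_right, norm_smul, mul_pow, Real.norm_eq_abs, sq_abs]
  ring

variable [FiniteDimensional ℝ E] {U : Set E}

/-- A ball about a maximal centre cannot be blown up from one of its points of contact. -/
lemma exists_mem_compl_of_maxCenter (hne : Uᶜ.Nonempty) {x q : E} (hx : x ∈ maxCenters U)
    (hd : dist x q = depth U x) (h0 : 0 < depth U x) {ε : ℝ} (hε : 0 < ε) :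
    ∃ z ∈ Uᶜ, dist z (x + ε • (x - q)) < (1 + ε) * depth U x := by
  have hxq : x - q ≠ 0 := by
    intro h
    rw [sub_eq_zero.1 h, dist_self] at hd
    rw [sub_eq_zero.1 h, ← hd] at h0
    exact h0.false
  have hdist : dist x (x + ε • (x - q)) = ε * depth U x := by
    rw [dist_self_add_right, norm_smul, Real.norm_of_nonneg hε.le, ← dist_eq_norm, hd]
  have hlt : depth U (x + ε • (x - q)) < (1 + ε) * depth U x := by
    by_contra! hle
    have := hx.2 (x + ε • (x - q)) (by unfold Below; rw [hdist]; linarith)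
    rw [add_eq_left, smul_eq_zero] at this
    exact this.elim hε.ne' hxq
  obtain ⟨z, hz, h⟩ := (infDist_lt_iff hne).1 hlt
  exact ⟨z, hz, by rwa [dist_comm]⟩

variable {ι : Type*} [Fintype ι] {c : ι → E} {r : ι → ℝ}

lemma isCompact_iUnion_closedBall : IsCompact (⋃ i, closedBall (c i) (r i)) :=
  isCompact_iUnion fun i => isCompact_closedBall (c i) (r i)

lemma le_dist_of_mem_closure {z : E} (hz : z ∈ closure (⋃ i, closedBall (c i) (r i))ᶜ) (i : ι) :
    r i ≤ dist z (c i) := by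
  have hcl : IsClosed {z : E | r i ≤ dist z (c i)} :=
    isClosed_le continuous_const (continuous_id.dist continuous_const)
  refine closure_minimal (fun y hy => ?_) hcl hz
  simp only [mem_compl_iff, mem_iUnion, not_exists, mem_closedBall, not_le] at hy
  exact (hy i).le

/-- A point of depth zero is below the centre of any of the balls containing it. -/
lemma depth_pos_of_maxCenter (hr : ∀ i, 0 < r i) (hne : (⋃ i, closedBall (c i) (r i))ᶜ.Nonempty)
    {x : E} (hx : x ∈ maxCenters (⋃ i, closedBall (c i) (r i))) :
    0 < depth (⋃ i, closedBall (c i) (r i)) x := by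
  refine (depth_nonneg x).lt_of_ne fun h => ?_
  obtain ⟨i, hi⟩ := mem_iUnion.1 hx.1
  have h1 : r i ≤ depth _ (c i) := le_depth hne (subset_iUnion (fun i => closedBall (c i) (r i)) i)
  have h2 := hx.2 (c i) (by unfold Below; rw [← h]; linarith [mem_closedBall.1 hi])
  rw [h2] at h1
  linarith [hr i]

/-- Near a boundary point of a finite union of balls, inversion about that point turns the
complement into a polyhedron. -/
lemma exists_radius_polyhedron {q : E} (hq : ∀ i, r i ≤ dist q (c i)) :
    ∃ R : ℝ, 0 < R ∧ ∀ w : E, R < ‖w‖ → (q + unitInv w ∈ (⋃ i, closedBall (c i) (r i))ᶜ ↔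
      w ∈ polyhedron {i | dist q (c i) = r i} fun i => c i - q) := by
  have hev : ∀ᶠ z in 𝓝 q, ∀ i, dist q (c i) ≠ r i → r i < dist z (c i) := by
    refine eventually_all.2 fun i => ?_
    by_cases hi : dist q (c i) = r i
    · simp [hi]
    · have hcont : Continuous fun z => dist z (c i) := continuous_id.dist continuous_const
      filter_upwards [hcont.continuousAt.eventually (lt_mem_nhds ((hq i).lt_of_ne' hi))] with z hz _
        using hz
  obtain ⟨η, hη, hball⟩ := Metric.eventually_nhds_iff.1 hev
  refine ⟨η⁻¹, by positivity, fun w hw => ?_⟩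
  have hw0 : 0 < ‖w‖ := (by positivity : 0 < η⁻¹).trans hw
  have hwne : w ≠ 0 := norm_pos_iff.1 hw0
  have hnear : dist (q + unitInv w) q < η := by
    rw [dist_self_add_left, norm_unitInv]
    exact inv_lt_of_inv_lt₀ hη hw
  simp only [mem_compl_iff, mem_iUnion, not_exists, mem_closedBall, not_le]
  have hiff : ∀ i, dist q (c i) = r i → (r i < dist (q + unitInv w) (c i) ↔ 2 * ⟪w, c i - q⟫ < 1) := by
    intro i hi
    rw [← lt_norm_unitInv_sub_iff hwne, ← hi, dist_comm q, dist_eq_norm, dist_eq_norm,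
      show q + unitInv w - c i = unitInv w - (c i - q) by abel]
  constructor
  · intro h i hi
    exact (hiff i hi).1 (h i)
  · intro h i
    by_cases hi : dist q (c i) = r i
    · exact (hiff i hi).2 (h i hi)
    · exact hball hnear i hi

/-- The central set of a finite union of balls in a Euclidean space is closed. -/
theorem isClosed_maxCenters (hr : ∀ i, 0 < r i)
    (hne : (⋃ i, closedBall (c i) (r i))ᶜ.Nonempty) :
    IsClosed (maxCenters (⋃ i, closedBall (c i) (r i))) := by
  set U : Set E := ⋃ i, closedBall (c i) (r i) with hU
  have hUc : IsCompact U := isCompact_iUnion_closedBall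
  refine isClosed_of_closure_subset fun x hx => ?_
  have hxU : x ∈ U := closure_minimal (fun y hy => hy.1) hUc.isClosed hx
  refine ⟨hxU, fun y hxy => ?_⟩
  by_contra hyx
  obtain ⟨q, hq, hdx⟩ := exists_nearest hne x
  obtain ⟨hdy, hw⟩ := hxy.wbtw hq hdx
  have hqU : q ∈ U := closedBall_depth_subset hUc.isClosed hxU (by
    rw [mem_closedBall, dist_comm, hdx])
  obtain ⟨t, ht0, ht1, hxt⟩ : ∃ t : ℝ, 0 ≤ t ∧ t < 1 ∧ x - q = t • (y - q) := by
    obtain ⟨t, ⟨ht0, ht1⟩, rfl⟩ := hw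
    refine ⟨t, ht0, ht1.lt_of_ne ?_, ?_⟩
    · rintro rfl
      simp at hyx
    · simp [AffineMap.lineMap_apply]
  obtain ⟨R, hR, hloc⟩ := exists_radius_polyhedron (r := r) (fun i => le_dist_of_mem_closure hq i)
  set γ : ι → E := fun i => c i - q with hγ
  set I : Set ι := {i | dist q (c i) = r i} with hI
  -- Points of the closed complement are separated from the ball about `x`.
  have hgap : ∀ z ∈ closure Uᶜ, ‖x - q‖ ^ 2 + (1 - t) * ‖z - q‖ ^ 2 ≤ ‖z - x‖ ^ 2 := by
    intro z hz
    have h1 := depth_le_dist (x := y) hz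
    rw [← hdy, dist_eq_norm, dist_comm, dist_eq_norm,
      show z - y = (z - q) - (y - q) by abel] at h1
    have := norm_sub_smul_sq ht0 h1
    rwa [← hxt, show z - q - (x - q) = z - x by abel] at this
  -- The ball about `y` bounds the functional of `y - q` by `1` on the far part, hence that of `x -
  -- q` by `t < 1`.
  have hnotin : x - q ∉ unboundedFaces I γ R := by
    refine notMem_unboundedFaces ht1 fun w hwP hwR => ?_
    have hz := (hloc w hwR).2 hwP
    have hw0 : w ≠ 0 := norm_pos_iff.1 (hR.trans hwR)
    have h1 := depth_le_dist (x := y) (subset_closure hz)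
    rw [← hdy, dist_eq_norm, dist_comm, dist_eq_norm,
      show q + unitInv w - y = unitInv w - (y - q) by abel, le_norm_unitInv_sub_iff hw0] at h1
    rw [hxt, inner_smul_right]
    nlinarith
  obtain ⟨δ, hδ, hnear⟩ : ∃ δ > 0, ∀ z ∈ closure Uᶜ, dist z x < depth U x + δ →
      ‖z - q‖ < (R + 1)⁻¹ := by
    have hcont : ContinuousAt (fun δ : ℝ => (depth U x + δ) ^ 2) 0 := by fun_prop
    have hpos : 0 < (1 - t) * ((R + 1)⁻¹) ^ 2 := by
      have : 0 < 1 - t := by linarith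
      positivity
    have hev := hcont.eventually (gt_mem_nhds
      (show (depth U x + 0) ^ 2 < depth U x ^ 2 + (1 - t) * ((R + 1)⁻¹) ^ 2 by
        rw [add_zero]; linarith))
    obtain ⟨δ, hδ, hδ'⟩ := (hev.filter_mono nhdsWithin_le_nhds |>.and
      (self_mem_nhdsWithin (s := Ioi (0 : ℝ)))).exists
    refine ⟨δ, hδ', fun z hz hzx => ?_⟩
    have h1 := hgap z hz
    have h2 : ‖z - x‖ ^ 2 < (depth U x + δ) ^ 2 := by
      rw [← dist_eq_norm]
      gcongr
    rw [← dist_eq_norm x q, hdx] at h1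
    have h3 : (1 - t) * ‖z - q‖ ^ 2 < (1 - t) * ((R + 1)⁻¹) ^ 2 := by linarith
    exact lt_of_pow_lt_pow_left₀ 2 (by positivity) (lt_of_mul_lt_mul_left h3 (by linarith))
  refine hnotin ?_
  have hQ : IsClosed {x' : E | x' - q ∈ unboundedFaces I γ R} :=
    (isClosed_unboundedFaces R).preimage (continuous_id.sub continuous_const)
  have hx' : x ∈ closure (maxCenters U ∩ ball x (δ / 4)) := by
    rw [inter_comm]
    exact isOpen_ball.inter_closure ⟨mem_ball_self (by positivity), hx⟩
  refine closure_minimal ?_ hQ hx'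
  rintro x' ⟨hx'C, hx'x⟩
  rw [mem_ball] at hx'x
  have hρ : depth U x' ≤ depth U x + dist x' x := infDist_le_infDist_add_dist
  have hρ0 : 0 < depth U x' := depth_pos_of_maxCenter hr hne hx'C
  -- Blowing the ball about `x'` up a little meets the complement near `q`.
  have hblow : ∃ ε₀ > 0, ∀ ε, 0 < ε → ε ≤ ε₀ → ∀ q', dist x' q' = depth U x' →
      ∃ z ∈ Uᶜ, ‖z - q‖ < (R + 1)⁻¹ ∧
        (1 + ε) * (‖z - x'‖ ^ 2 - depth U x' ^ 2) < ε * ‖z - q'‖ ^ 2 := by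
    -- Dilating and shifting the centre cost at most `2 * ε * depth U x' ≤ δ / 4`, and `x'` is
    -- within `δ / 4` of `x`, so `z` stays in the range of `hnear`.
    refine ⟨δ / (8 * depth U x'), by positivity, fun ε hε hε' q' hq' => ?_⟩
    obtain ⟨z, hz, hzd⟩ := exists_mem_compl_of_maxCenter hne hx'C hq' hρ0 hε
    rw [le_div_iff₀ (by positivity)] at hε'
    refine ⟨z, hz, hnear z (subset_closure hz) ?_, ?_⟩
    · have h1 := dist_triangle4 z (x' + ε • (x' - q')) x' x
      have h2 : dist (x' + ε • (x' - q')) x' = ε * depth U x' := by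
        rw [dist_self_add_left, norm_smul, Real.norm_of_nonneg hε.le, ← dist_eq_norm, hq']
      linarith
    · have h1 := norm_sub_add_smul_sq z x' q' ε
      rw [← dist_eq_norm x' q', hq'] at h1
      have h2 : ‖z - (x' + ε • (x' - q'))‖ ^ 2 < ((1 + ε) * depth U x') ^ 2 := by
        rw [← dist_eq_norm]
        gcongr
      rw [mul_pow] at h2
      linarith
  set ξ : E := x' - q with hξ
  -- The power of `q` with respect to the ball about `x'`. It vanishes when that ball touches `q`,
  -- and then the inverted ball is a half-space and the linear theory applies; if it is positive,
  -- quadratic growth contradicts maximality.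
  set e : ℝ := ‖ξ‖ ^ 2 - depth U x' ^ 2 with he
  have he0 : 0 ≤ e := by
    have h1 := depth_le_dist (x := x') hq
    rw [dist_eq_norm] at h1
    have : depth U x' ^ 2 ≤ ‖ξ‖ ^ 2 := by gcongr
    linarith
  have hform : ∀ w : E, w ≠ 0 → ‖w‖ ^ 2 * (‖q + unitInv w - x'‖ ^ 2 - depth U x' ^ 2) =
      1 - 2 * ⟪w, ξ⟫ + e * ‖w‖ ^ 2 := by
    intro w hw
    have h1 := norm_sq_mul_norm_unitInv_sub_sq hw ξ
    rw [show q + unitInv w - x' = unitInv w - ξ by rw [hξ]; abel, mul_sub, h1, he]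
    ring
  have hg : ∀ w ∈ polyhedron I γ, R < ‖w‖ → 0 ≤ 1 - 2 * ⟪w, ξ⟫ + e * ‖w‖ ^ 2 := by
    intro w hwP hwR
    have hz := (hloc w hwR).2 hwP
    rw [← hform w (norm_pos_iff.1 (hR.trans hwR))]
    have h1 := depth_le_dist (x := x') (subset_closure hz)
    rw [dist_comm, dist_eq_norm] at h1
    have : depth U x' ^ 2 ≤ ‖q + unitInv w - x'‖ ^ 2 := by gcongr
    have : 0 ≤ ‖q + unitInv w - x'‖ ^ 2 - depth U x' ^ 2 := by linarith
    positivity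
  have hinv : ∀ z, z ≠ q → ‖z - q‖ < (R + 1)⁻¹ → R + 1 < ‖unitInv (z - q)‖ := by
    intro z hz h
    rw [norm_unitInv]
    exact (lt_inv_comm₀ (norm_pos_iff.2 (sub_ne_zero.2 hz)) (by positivity)).1 h
  have hqinv : ∀ z, q + unitInv (unitInv (z - q)) = z := fun z => by rw [unitInv_unitInv]; abel
  rcases he0.eq_or_lt with he0 | he0
  · rw [← he0] at hg hform
    refine mem_unboundedFaces hR.le (fun w hwP hwR => by linarith [hg w hwP hwR]) ?_
    intro θ hθ
    obtain ⟨ε₀, hε₀, hb⟩ := hblow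
    have hdq : dist x' q = depth U x' := by
      rw [dist_eq_norm]
      exact (sq_eq_sq₀ (norm_nonneg _) hρ0.le).1 (by linarith)
    obtain ⟨z, hz, hzq, hzε⟩ := hb (min ε₀ θ) (by positivity) (min_le_left _ _) q hdq
    have hzne : z ≠ q := fun h => hz (h ▸ hqU)
    have hwR := hinv z hzne hzq
    refine ⟨unitInv (z - q), (hloc _ (by linarith)).1 (by rwa [hqinv]), hwR, ?_⟩
    have hw0 : 0 < ‖unitInv (z - q)‖ := by linarith
    have h1 := hform _ (norm_pos_iff.1 hw0)
    rw [hqinv] at h1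
    have h2 : ‖unitInv (z - q)‖ ^ 2 * ‖z - q‖ ^ 2 = 1 := by
      rw [norm_unitInv]
      have := norm_pos_iff.2 (sub_ne_zero.2 hzne)
      field_simp
    have h3 := mul_lt_mul_of_pos_left hzε (show 0 < ‖unitInv (z - q)‖ ^ 2 by positivity)
    have h4 : (1 + min ε₀ θ) * (1 - 2 * ⟪unitInv (z - q), ξ⟫) < min ε₀ θ := by
      calc _ = ‖unitInv (z - q)‖ ^ 2 * ((1 + min ε₀ θ) * (‖z - x'‖ ^ 2 - depth U x' ^ 2)) := by
            linear_combination (-(1 + min ε₀ θ)) * h1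
        _ < _ := h3
        _ = _ := by linear_combination (min ε₀ θ) * h2
    have h5 : min ε₀ θ ≤ θ := min_le_right _ _
    have h6 : 0 < min ε₀ θ := by positivity
    by_contra! hc
    nlinarith
  · exfalso
    obtain ⟨q', hq', hdq'⟩ := exists_nearest hne x'
    have hq'q : q' ≠ q := by
      rintro rfl
      rw [dist_eq_norm] at hdq'
      rw [he, hξ, hdq'] at he0
      linarith
    have hq'R := hinv q' hq'q (hnear q' hq' (by
      have := dist_triangle q' x' x
      rw [dist_comm q' x', hdq'] at this
      linarith))
    set w' := unitInv (q' - q) with hw'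
    have hw'0 : 0 < ‖w'‖ := by linarith
    have hw'ne := norm_pos_iff.1 hw'0
    have hw'P : ∀ i ∈ I, 2 * ⟪w', γ i⟫ ≤ 1 := by
      intro i hi
      have h1 := le_dist_of_mem_closure hq' i
      have h2 : dist q (c i) = r i := hi
      rw [← h2, dist_comm q, dist_eq_norm, dist_eq_norm, ← hqinv q',
        show q + unitInv (unitInv (q' - q)) - c i = unitInv (unitInv (q' - q)) - (c i - q) by abel] at h1
      exact (le_norm_unitInv_sub_iff hw'ne).1 h1
    have h0 : 1 - 2 * ⟪w', ξ⟫ + e * ‖w'‖ ^ 2 = 0 := by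
      rw [← hform w' hw'ne, hw', hqinv, ← dist_eq_norm, dist_comm, hdq']
      ring
    obtain ⟨ε₀, hε₀, hb⟩ := hblow
    -- Quadratic growth with constant `e` and the blow-up inequality together would force `(1 + ε) *
    -- e * ‖w'‖² < ε`, impossible once `ε ≤ e * ‖w'‖²`.
    have hεpos : 0 < min ε₀ (e * ‖w'‖ ^ 2) := by positivity
    obtain ⟨z, hz, hzq, hzε⟩ := hb (min ε₀ (e * ‖w'‖ ^ 2)) hεpos (min_le_left _ _) q' hdq'
    set ε := min ε₀ (e * ‖w'‖ ^ 2) with hε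
    have hzne : z ≠ q := fun h => hz (h ▸ hqU)
    have hwR := hinv z hzne hzq
    set w := unitInv (z - q) with hw
    have hw0 : 0 < ‖w‖ := by linarith
    have hwne := norm_pos_iff.1 hw0
    have hwP : w ∈ polyhedron I γ := (hloc _ (by linarith)).1 (by rwa [hw, hqinv])
    have h1 := quadratic_growth hw'P (by linarith) hg h0 hwP
    have h2 := hform w hwne
    have h3 := norm_unitInv_sub_unitInv_sq hwne hw'ne
    rw [hw, hqinv] at h2
    rw [show unitInv w - unitInv w' = z - q' by rw [hw, hw', unitInv_unitInv, unitInv_unitInv]; abel] at h3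
    have h4 := mul_lt_mul_of_pos_left hzε (show 0 < ‖w‖ ^ 2 * ‖w'‖ ^ 2 by positivity)
    have h5 : (1 + ε) * ‖w'‖ ^ 2 * (e * ‖w - w'‖ ^ 2) < ε * ‖w - w'‖ ^ 2 := by
      calc _ ≤ (1 + ε) * ‖w'‖ ^ 2 * (1 - 2 * ⟪w, ξ⟫ + e * ‖w‖ ^ 2) := by gcongr
        _ = ‖w‖ ^ 2 * ‖w'‖ ^ 2 * ((1 + ε) * (‖z - x'‖ ^ 2 - depth U x' ^ 2)) := by
            linear_combination (-(1 + ε) * ‖w'‖ ^ 2) * h2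
        _ < _ := h4
        _ = _ := by linear_combination ε * h3
    have h6 : ε ≤ e * ‖w'‖ ^ 2 := min_le_right _ _
    have h7 : 0 ≤ ‖w - w'‖ ^ 2 := by positivity
    have h8 : ε * ‖w - w'‖ ^ 2 ≤ e * ‖w'‖ ^ 2 * ‖w - w'‖ ^ 2 := by gcongr
    have h9 : 0 ≤ ε * (‖w'‖ ^ 2 * (e * ‖w - w'‖ ^ 2)) := by positivity
    linarith

end Closedness

end BallUnion

namespace BallUnion

open Metric Set Filter Topology CentralSet

/-! ### The lemma in a chart that preserves balls -/

section Chart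

/-- A chart of `M` in a Euclidean space that exchanges geodesic balls and Euclidean balls. -/
structure BallChart (M : Type) [TopologicalSpace M] [GeodesicDist M] (E : Type*)
    [NormedAddCommGroup E] [InnerProductSpace ℝ E] where
  /-- The chart. -/
  chart : OpenPartialHomeomorph M E
  /-- The geodesic centre of the image in `M` of a Euclidean ball. -/
  center : E → ℝ → M
  continuousOn_center : ContinuousOn (fun z : E × ℝ => center z.1 z.2)
    {z | 0 ≤ z.2 ∧ closedBall z.1 z.2 ⊆ chart.target}
  exists_image : ∀ x r, 0 ≤ r → cball x r ⊆ chart.source →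
    ∃ a s, 0 ≤ s ∧ (0 < r → 0 < s) ∧ chart '' cball x r = closedBall a s ∧ center a s = x
  exists_preimage : ∀ a s, 0 ≤ s → closedBall a s ⊆ chart.target →
    ∃ r, 0 ≤ r ∧ cball (center a s) r ⊆ chart.source ∧
      chart '' cball (center a s) r = closedBall a s

variable {M : Type} [TopologicalSpace M] [GeodesicDist M] {E : Type*}
  [NormedAddCommGroup E] [InnerProductSpace ℝ E] [FiniteDimensional ℝ E] [Nontrivial E]

lemma exists_maximalBall_of_mem_maxCenters (Φ : BallChart M E) {U : Set M}
    (hUs : U ⊆ Φ.chart.source) (hc : IsCompact (Φ.chart '' U)) (hne : (Φ.chart '' U)ᶜ.Nonempty)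
    {a : E} (ha : a ∈ maxCenters (Φ.chart '' U)) :
    ∃ r, IsMaximalBall U (Φ.center a (depth (Φ.chart '' U) a)) r ∧
      Φ.chart '' cball (Φ.center a (depth (Φ.chart '' U) a)) r =
        closedBall a (depth (Φ.chart '' U) a) := by
  set V := Φ.chart '' U
  have hsub : closedBall a (depth V a) ⊆ V := closedBall_depth_subset hc.isClosed ha.1
  have hVt : V ⊆ Φ.chart.target := Φ.chart.mapsTo.mono_left hUs |>.image_subset
  obtain ⟨r, hr, hrs, him⟩ := Φ.exists_preimage a _ (depth_nonneg a) (hsub.trans hVt)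
  refine ⟨r, ⟨hr, ?_, fun y s hs hys hss => ?_⟩, him⟩
  · rw [← Φ.chart.injOn.image_subset_image_iff hrs hUs, him]
    exact hsub
  · obtain ⟨b, u, hu, -, hb, -⟩ := Φ.exists_image y s hs (hys.trans hUs)
    have h1 := dist_le_sub_of_closedBall_subset (depth_nonneg a)
      (him ▸ hb ▸ image_mono hss.subset : closedBall a (depth V a) ⊆ closedBall b u)
    have h2 : u ≤ depth V b := le_depth hne (hb ▸ image_mono hys)
    obtain rfl := ha.2 b (h1.trans (by linarith))
    refine hss.not_subset ?_
    rw [← Φ.chart.injOn.image_subset_image_iff (hys.trans hUs) hrs, him, hb]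
    exact closedBall_subset_closedBall h2

lemma exists_mem_maxCenters_of_maximalBall (Φ : BallChart M E) {U : Set M}
    (hUs : U ⊆ Φ.chart.source) (hc : IsCompact (Φ.chart '' U)) (hne : (Φ.chart '' U)ᶜ.Nonempty)
    {x : M} {r : ℝ} (h : IsMaximalBall U x r) :
    ∃ a ∈ maxCenters (Φ.chart '' U), Φ.center a (depth (Φ.chart '' U) a) = x ∧
      Φ.chart '' cball x r = closedBall a (depth (Φ.chart '' U) a) := by
  obtain ⟨b, u, hu, -, hb, hbx⟩ := Φ.exists_image x r h.1 (h.2.1.trans hUs)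
  have hbV : closedBall b u ⊆ Φ.chart '' U := hb ▸ image_mono h.2.1
  obtain ⟨a, ha, hba⟩ := exists_below hc (hbV (mem_closedBall_self hu))
  obtain ⟨s, hs, him⟩ := exists_maximalBall_of_mem_maxCenters Φ hUs hc hne ha
  have hsub := hba.closedBall_subset (le_depth hne hbV)
  rw [← hb, ← him, Φ.chart.injOn.image_subset_image_iff (h.2.1.trans hUs) (hs.2.1.trans hUs)]
    at hsub
  have heq := hsub.eq_of_not_ssubset (h.2.2 _ s hs.1 hs.2.1)
  rw [← heq, hb] at him
  obtain ⟨rfl, hd⟩ := closedBall_injective hu (depth_nonneg a) him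
  exact ⟨b, ha, by rw [← hd, hbx], by rw [hb, hd]⟩

lemma subset_centralSet_maximalBallUnion {M : Type} [GeodesicDist M] {U X : Set M}
    (hXC : X ⊆ centralSet U) : X ⊆ centralSet (maximalBallUnion U X) := by
  intro x hx
  obtain ⟨r, hr⟩ := hXC hx
  refine ⟨r, hr.1, fun p hp => ⟨x, hx, r, hr, hp⟩, fun y s hs hys => hr.2.2 y s hs (hys.trans ?_)⟩
  rintro p ⟨x', -, r', hr', hp⟩
  exact hr'.2.1 hp

lemma isClosed_relBoundary {M : Type} [TopologicalSpace M] {C X : Set M} (hC : IsClosed C) : IsClosed (relBoundary C X) :=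
  hC.isClosedEmbedding_subtypeVal.isClosedMap _ isClosed_frontier

/-- Without such a point, the relative interior and exterior of `X` would separate `S`. -/
lemma exists_mem_relBoundary {M : Type} [TopologicalSpace M] {C X S : Set M} (hSC : S ⊆ C)
    (hS : IsPreconnected S) {x y : M} (hxS : x ∈ S) (hyS : y ∈ S) (hx : x ∈ X) (hy : y ∉ X) :
    ∃ z ∈ S, z ∈ relBoundary C X := by
  have hS' : IsPreconnected (((↑) : C → M) ⁻¹' S) := by
    rw [← IsInducing.subtypeVal.isPreconnected_image, Subtype.image_preimage_coe,
      inter_eq_right.2 hSC]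
    exact hS
  by_contra! h
  have hd : Disjoint (((↑) : C → M) ⁻¹' S) (frontier (((↑) : C → M) ⁻¹' X)) :=
    disjoint_left.2 fun z hz hzf => h z hz ⟨z, hzf, rfl⟩
  have hclopen : ((↑) : C → M) ⁻¹' S ⊆ interior (((↑) : C → M) ⁻¹' X) := by
    refine hS'.subset_left_of_subset_union isOpen_interior
      (isClosed_closure (s := ((↑) : C → M) ⁻¹' X)).isOpen_compl ?_ ?_ ?_
    · exact disjoint_left.2 fun z hz hz' => hz' (interior_subset_closure hz)
    · intro z hz
      by_contra hc
      rw [mem_union, not_or, mem_compl_iff, not_not] at hc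
      exact disjoint_left.1 hd hz ⟨hc.2, hc.1⟩
    · refine ⟨⟨x, hSC hxS⟩, hxS, ?_⟩
      by_contra hc
      have hxX : (⟨x, hSC hxS⟩ : C) ∈ ((↑) : C → M) ⁻¹' X := hx
      have hxS' : (⟨x, hSC hxS⟩ : C) ∈ ((↑) : C → M) ⁻¹' S := hxS
      exact disjoint_left.1 hd hxS' ⟨subset_closure hxX, hc⟩
  have hyS' : (⟨y, hSC hyS⟩ : C) ∈ ((↑) : C → M) ⁻¹' S := hyS
  exact hy (interior_subset (hclopen hyS') : (⟨y, hSC hyS⟩ : C) ∈ ((↑) : C → M) ⁻¹' X)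

theorem centralSet_maximalBallUnion_of_chart [T2Space M] (Φ : BallChart M E) {U X : Set M}
    (hUs : U ⊆ Φ.chart.source)
    (hU : ∃ (k : ℕ) (c : Fin k → M) (r : Fin k → ℝ),
      (∀ i, 0 < r i) ∧ U = ⋃ i, cball (c i) (r i))
    (hXC : X ⊆ centralSet U) (hX : IsClosed X)
    (hZ : centralSet (maximalBallUnion U (relBoundary (centralSet U) X)) ⊆ X) :
    centralSet (maximalBallUnion U X) = X := by
  set V := Φ.chart '' U with hV
  have hVball : ∃ (k : ℕ) (a : Fin k → E) (s : Fin k → ℝ),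
      (∀ i, 0 < s i) ∧ V = ⋃ i, closedBall (a i) (s i) := by
    obtain ⟨k, c, r, hr, rfl⟩ := hU
    choose a s hs0 hs him _ using fun i => Φ.exists_image (c i) (r i) (hr i).le
      ((subset_iUnion (fun i => cball (c i) (r i)) i).trans hUs)
    exact ⟨k, a, s, fun i => hs i (hr i), by rw [hV, image_iUnion]; exact iUnion_congr him⟩
  have hc : IsCompact V := by
    obtain ⟨k, a, s, -, h⟩ := hVball
    exact h ▸ isCompact_iUnion_closedBall
  have hne : Vᶜ.Nonempty := by
    have : NoncompactSpace E := NormedSpace.noncompactSpace ℝ E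
    exact nonempty_compl.2 hc.ne_univ
  have hC : IsClosed (maxCenters V) := by
    obtain ⟨k, a, s, hs, h⟩ := hVball
    exact h ▸ isClosed_maxCenters hs (h ▸ hne)
  have hCc : IsCompact (maxCenters V) := hc.of_isClosed_subset hC fun a ha => ha.1
  have hVt : V ⊆ Φ.chart.target := Φ.chart.mapsTo.mono_left hUs |>.image_subset
  set κ : E → M := fun a => Φ.center a (depth V a) with hκ
  have hκc : ContinuousOn κ (maxCenters V) := by
    refine Φ.continuousOn_center.comp
      (continuous_id.prodMk continuous_depth).continuousOn fun a ha => ?_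
    exact ⟨depth_nonneg a, (closedBall_depth_subset hc.isClosed ha.1).trans hVt⟩
  have hκC : κ '' maxCenters V = centralSet U := by
    ext x
    constructor
    · rintro ⟨a, ha, rfl⟩
      obtain ⟨r, hr, -⟩ := exists_maximalBall_of_mem_maxCenters Φ hUs hc hne ha
      exact ⟨r, hr⟩
    · rintro ⟨r, hr⟩
      obtain ⟨a, ha, hax, -⟩ := exists_mem_maxCenters_of_maximalBall Φ hUs hc hne hr
      exact ⟨a, ha, hax⟩
  set Z := relBoundary (centralSet U) X with hZdef
  have hZcl : IsClosed Z :=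
    isClosed_relBoundary (hκC ▸ (hCc.image_of_continuousOn hκc).isClosed)
  -- The union of the maximal balls with centre in `Z`, seen in the chart.
  set W : Set E := {p | ∃ a ∈ maxCenters V ∩ κ ⁻¹' Z, p ∈ closedBall a (depth V a)} with hW
  have hWcl : IsClosed W := by
    have hcomp : IsCompact ((V ×ˢ (maxCenters V ∩ κ ⁻¹' Z)) ∩
        {z : E × E | dist z.1 z.2 ≤ depth V z.2}) :=
      (hc.prod (hCc.of_isClosed_subset (hκc.preimage_isClosed_of_isClosed hC hZcl)
        inter_subset_left)).inter_right
        (isClosed_le (continuous_fst.dist continuous_snd) (continuous_depth.comp continuous_snd))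
    convert (hcomp.image continuous_fst).isClosed using 1
    ext p
    constructor
    · rintro ⟨a, ha, hp⟩
      exact ⟨(p, a), ⟨⟨closedBall_depth_subset hc.isClosed ha.1.1 hp, ha⟩, hp⟩, rfl⟩
    · rintro ⟨⟨p, a⟩, ⟨⟨-, ha⟩, hp⟩, rfl⟩
      exact ⟨a, ha, hp⟩
  have hXU : maximalBallUnion U X ⊆ U := by
    rintro p ⟨x, -, r, hr, hp⟩
    exact hr.2.1 hp
  refine Subset.antisymm ?_ (subset_centralSet_maximalBallUnion hXC)
  rintro y ⟨r, hyr⟩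
  have hBU := hyr.2.1.trans hXU
  obtain ⟨b, s, hs, -, hb, hby⟩ := Φ.exists_image y r hyr.1 (hBU.trans hUs)
  have hbV : closedBall b s ⊆ V := hb ▸ image_mono hBU
  -- A maximal ball about a point of `X` that contains the given ball equals it.
  have hmeet : ∀ a ∈ maxCenters V, κ a ∈ X → closedBall b s ⊆ closedBall a (depth V a) → y ∈ X := by
    intro a ha haX hsub
    obtain ⟨u, hu, him⟩ := exists_maximalBall_of_mem_maxCenters Φ hUs hc hne ha
    rw [← hb, ← him, Φ.chart.injOn.image_subset_image_iff (hBU.trans hUs) (hu.2.1.trans hUs)]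
      at hsub
    have heq := hsub.eq_of_not_ssubset
      (hyr.2.2 _ u hu.1 fun p hp => ⟨κ a, haX, u, hu, hp⟩)
    rw [← heq, hb] at him
    obtain ⟨rfl, hd⟩ := closedBall_injective hs (depth_nonneg a) him
    rw [← hby, hd]
    exact haX
  obtain ⟨a, ha, hba⟩ := exists_below hc (hbV (mem_closedBall_self hs))
  have hsub := hba.closedBall_subset (le_depth hne hbV)
  by_cases haX : κ a ∈ X
  · exact hmeet a ha haX hsub
  -- A ball of radius zero has no interior points, but its single point already lies in a maximal
  -- ball centred in `X`.
  rcases hs.eq_or_lt with rfl | hs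
  · rw [closedBall_zero] at hb
    have hbmem : b ∈ Φ.chart '' cball y r := hb ▸ mem_singleton b
    obtain ⟨p, hp, hpb⟩ := hbmem
    obtain ⟨x, hx, u, hu, hpu⟩ := hyr.2.1 hp
    obtain ⟨a', ha', hax', him⟩ := exists_mem_maxCenters_of_maximalBall Φ hUs hc hne hu
    refine hmeet a' ha' (by rw [← hax'] at hx; exact hx) ?_
    rw [closedBall_zero, singleton_subset_iff, ← him, ← hpb]
    exact mem_image_of_mem _ hpu
  · have hballW : ball b s ⊆ W := by
      intro p' hp'
      have hp'B : p' ∈ Φ.chart '' cball y r := hb ▸ ball_subset_closedBall hp'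
      obtain ⟨p, hp, rfl⟩ := hp'B
      obtain ⟨x, hx, u, hu, hpu⟩ := hyr.2.1 hp
      obtain ⟨a', ha', hax', him⟩ := exists_mem_maxCenters_of_maximalBall Φ hUs hc hne hu
      -- Connectedness of the set of centres is available only at interior points of `V`; the rest
      -- of the ball is reached at the end because `W` is closed.
      have hpos : 0 < depth V (Φ.chart p) := by
        refine (infDist_pos_iff_notMem_closure hne).1 fun hcl => ?_
        have := (disjoint_compl_right.mono_left (ball_subset_closedBall.trans hbV)).closure_right
          isOpen_ball
        exact disjoint_left.1 this hp' hcl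
      have hconn : IsPreconnected
          (κ '' {a ∈ maxCenters V | Φ.chart p ∈ closedBall a (depth V a)}) :=
        (isPreconnected_centers hc hne hC hpos).image _ (hκc.mono fun a ha => ha.1)
      obtain ⟨z, ⟨a'', ha'', rfl⟩, hzZ⟩ := exists_mem_relBoundary (C := centralSet U) (X := X)
        (hκC ▸ image_mono fun a ha => ha.1) hconn (x := κ a') (y := κ a)
        ⟨a', ⟨ha', him ▸ mem_image_of_mem _ hpu⟩, rfl⟩
        ⟨a, ⟨ha, hsub (ball_subset_closedBall hp')⟩, rfl⟩ (by rw [← hax'] at hx; exact hx) haX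
      exact ⟨a'', ⟨ha''.1, hzZ⟩, ha''.2⟩
    have hBW : closedBall b s ⊆ W := by
      rw [← closure_ball b hs.ne']
      exact closure_minimal hballW hWcl
    have hBZ : cball y r ⊆ maximalBallUnion U Z := by
      intro p hp
      obtain ⟨a', ⟨ha', haZ⟩, hpa⟩ := hBW (hb ▸ mem_image_of_mem _ hp)
      obtain ⟨u, hu, him⟩ := exists_maximalBall_of_mem_maxCenters Φ hUs hc hne ha'
      rw [← him] at hpa
      obtain ⟨p', hp', hpp⟩ := hpa
      obtain rfl := Φ.chart.injOn (hUs (hu.2.1 hp')) (hUs (hBU hp)) hpp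
      exact ⟨_, haZ, u, hu, hp'⟩
    have hZX : Z ⊆ X := by
      rintro _ ⟨z, hz, rfl⟩
      exact (hX.preimage continuous_subtype_val).frontier_subset hz
    refine hZ ⟨r, hyr.1, hBZ, fun y' s' hs' hys' => hyr.2.2 y' s' hs' (hys'.trans ?_)⟩
    rintro p ⟨x, hx, u, hu, hp⟩
    exact ⟨x, hZX hx, u, hu, hp⟩

end Chart

end BallUnion

namespace BallUnion

open Metric Set Filter Topology CentralSet TopologicalSpace
open scoped RealInnerProductSpace

/-! ### The Euclidean chart -/

section Euclidean

/-- The identity chart of a Euclidean space. -/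
noncomputable def euclideanChart (n : ℕ) :
    BallChart (EuclideanSpace ℝ (Fin n)) (EuclideanSpace ℝ (Fin n)) where
  chart := OpenPartialHomeomorph.refl _
  center a _ := a
  continuousOn_center := continuous_fst.continuousOn
  exists_image x r hr _ := by
    refine ⟨x, r, hr, id, ?_, rfl⟩
    ext y
    simp [cball, GeodesicDist.gdist, dist_comm]
  exists_preimage a s hs _ := by
    refine ⟨s, hs, by simp, ?_⟩
    ext y
    simp [cball, GeodesicDist.gdist, dist_comm]

end Euclidean

/-! ### The hyperbolic chart -/

section Hyperbolic

variable {n : ℕ}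

lemma norm_lt_one (x : unitBall n) : ‖(x : EuclideanSpace ℝ (Fin n))‖ < 1 :=
  mem_ball_zero_iff.1 x.2

lemma one_sub_norm_sq_pos (x : unitBall n) : 0 < 1 - ‖(x : EuclideanSpace ℝ (Fin n))‖ ^ 2 := by
  have := norm_lt_one x
  nlinarith [norm_nonneg (x : EuclideanSpace ℝ (Fin n))]

lemma hyperbolic_gdist_le_iff (x y : unitBall n) {k : ℝ} (hk : 0 ≤ k) :
    GeodesicDist.gdist x y ≤ 2 * Real.arsinh k ↔
      ‖(y : EuclideanSpace ℝ (Fin n)) - x‖ ^ 2 ≤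
        k ^ 2 * (1 - ‖(x : EuclideanSpace ℝ (Fin n))‖ ^ 2) *
          (1 - ‖(y : EuclideanSpace ℝ (Fin n))‖ ^ 2) := by
  have hx := one_sub_norm_sq_pos x
  have hy := one_sub_norm_sq_pos y
  have hxy := mul_pos hx hy
  simp only [GeodesicDist.gdist]
  rw [mul_le_mul_iff_right₀ (by norm_num), Real.arsinh_le_arsinh,
    div_le_iff₀ (Real.sqrt_pos.2 hxy), ← sq_le_sq₀ (norm_nonneg _) (by positivity), mul_pow,
    Real.sq_sqrt hxy.le, norm_sub_rev, mul_assoc]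

/-- A hyperbolic ball is a Euclidean ball. -/
lemma hyperbolic_image_cball (x : unitBall n) {k : ℝ} (hk : 0 ≤ k)
    {a : EuclideanSpace ℝ (Fin n)} {s m : ℝ} (hs : 0 ≤ s)
    (hm : m = 1 + k ^ 2 * (1 - ‖(x : EuclideanSpace ℝ (Fin n))‖ ^ 2))
    (ha : (x : EuclideanSpace ℝ (Fin n)) = m • a)
    (hs2 : m * s ^ 2 = (m - 1) * (1 - m * ‖a‖ ^ 2)) :
    ((↑) : unitBall n → EuclideanSpace ℝ (Fin n)) '' cball x (2 * Real.arsinh k) =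
      closedBall a s := by
  have hx := one_sub_norm_sq_pos x
  have hm1 : 0 ≤ k ^ 2 * (1 - ‖(x : EuclideanSpace ℝ (Fin n))‖ ^ 2) := by positivity
  have hm0 : 0 < m := by linarith
  have hiff : ∀ y : EuclideanSpace ℝ (Fin n), y ∈ closedBall a s ↔
      ‖y - x‖ ^ 2 ≤ (m - 1) * (1 - ‖y‖ ^ 2) := by
    intro y
    rw [mem_closedBall, dist_eq_norm, ← sq_le_sq₀ (norm_nonneg _) hs,
      ← mul_le_mul_iff_right₀ hm0, hs2, ha, norm_sub_sq_real, norm_sub_sq_real,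
      inner_smul_right, norm_smul, mul_pow, Real.norm_eq_abs, sq_abs]
    constructor <;> intro <;> linarith
  ext y
  constructor
  · rintro ⟨y, hy, rfl⟩
    rw [hiff, hm, add_sub_cancel_left]
    exact (hyperbolic_gdist_le_iff x y hk).1 hy
  · intro hy
    rw [hiff] at hy
    have hy1 : ‖y‖ < 1 := by
      by_contra! hc
      have h1 : (m - 1) * (1 - ‖y‖ ^ 2) ≤ 0 :=
        mul_nonpos_of_nonneg_of_nonpos (by linarith) (by nlinarith)
      have h2 : ‖y - x‖ = 0 := by
        have := norm_nonneg (y - x)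
        nlinarith
      rw [sub_eq_zero.1 (norm_eq_zero.1 h2)] at hc
      exact hc.not_gt (norm_lt_one x)
    refine ⟨⟨y, mem_ball_zero_iff.2 hy1⟩, (hyperbolic_gdist_le_iff x _ hk).2 ?_, rfl⟩
    rwa [hm, add_sub_cancel_left] at hy

lemma norm_add_lt_one [Nontrivial (EuclideanSpace ℝ (Fin n))] {a : EuclideanSpace ℝ (Fin n)}
    {s : ℝ} (hs : 0 ≤ s) (h : closedBall a s ⊆ ball 0 1) : ‖a‖ + s < 1 := by
  rcases eq_or_ne a 0 with rfl | ha
  · obtain ⟨z, hz⟩ := NormedSpace.sphere_nonempty (x := (0 : EuclideanSpace ℝ (Fin n))) |>.2 hs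
    have := mem_ball_zero_iff.1 (h (sphere_subset_closedBall hz))
    rw [mem_sphere_zero_iff_norm.1 hz] at this
    simpa using this
  · have h0 : 0 < ‖a‖ := norm_pos_iff.2 ha
    have := h (show a + (s / ‖a‖) • a ∈ closedBall a s by
      rw [mem_closedBall, dist_self_add_left, norm_smul, Real.norm_of_nonneg (by positivity),
        div_mul_cancel₀ _ h0.ne'])
    rw [mem_ball_zero_iff, show a + (s / ‖a‖) • a = (1 + s / ‖a‖) • a by module, norm_smul,
      Real.norm_of_nonneg (by positivity), add_mul, one_mul, div_mul_cancel₀ _ h0.ne'] at this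
    exact this

/-- The ratio of the hyperbolic centre to the Euclidean centre of a ball, as a function of the
square `A` of the norm of the Euclidean centre and of the Euclidean radius `s`. -/
noncomputable def centerRatio (A s : ℝ) : ℝ :=
  2 / ((1 + A - s ^ 2) + √((1 + A - s ^ 2) ^ 2 - 4 * A))

/-- The ratio `m` is a root of `A m² - (1 + A - s²) m + 1 = 0` with `A = α²`. The rationalised form
in `centerRatio` picks the smaller root and remains valid at `A = 0`. -/
lemma centerRatio_spec {α s : ℝ} (hα : 0 ≤ α) (hs : 0 ≤ s) (h : α + s < 1) :
    0 < (1 + α ^ 2 - s ^ 2) + √((1 + α ^ 2 - s ^ 2) ^ 2 - 4 * α ^ 2) ∧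
    1 ≤ centerRatio (α ^ 2) s ∧ centerRatio (α ^ 2) s * α < 1 ∧
    centerRatio (α ^ 2) s * s ^ 2 =
      (centerRatio (α ^ 2) s - 1) * (1 - centerRatio (α ^ 2) s * α ^ 2) := by
  have hN : 2 * α < 1 + α ^ 2 - s ^ 2 := by nlinarith
  have hΔ : 0 ≤ (1 + α ^ 2 - s ^ 2) ^ 2 - 4 * α ^ 2 := by nlinarith
  have hsq := Real.sq_sqrt hΔ
  have hsqrt := Real.sqrt_nonneg ((1 + α ^ 2 - s ^ 2) ^ 2 - 4 * α ^ 2)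
  unfold centerRatio
  set d := √((1 + α ^ 2 - s ^ 2) ^ 2 - 4 * α ^ 2)
  have hD : 0 < (1 + α ^ 2 - s ^ 2) + d := by linarith
  refine ⟨hD, ?_, ?_, ?_⟩
  · rw [one_le_div hD]
    have : d ≤ 1 - α ^ 2 + s ^ 2 := by
      refine abs_le_of_sq_le_sq' (by nlinarith) (by nlinarith) |>.2
    linarith
  · rw [div_mul_eq_mul_div, div_lt_one hD]
    linarith
  · field_simp
    linear_combination hsq

/-- The Poincaré ball model seen as an open subset of `ℝⁿ`. -/
noncomputable def hyperbolicChart (n : ℕ) [Nontrivial (EuclideanSpace ℝ (Fin n))] :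
    BallChart (unitBall n) (EuclideanSpace ℝ (Fin n)) := by
  classical
  have h0 : (0 : EuclideanSpace ℝ (Fin n)) ∈ unitBall n := mem_ball_self one_pos
  exact
  { chart := (unitBall n).openPartialHomeomorphSubtypeCoe ⟨⟨0, h0⟩⟩
    center := fun a s => if h : centerRatio (‖a‖ ^ 2) s • a ∈ unitBall n then ⟨_, h⟩ else ⟨0, h0⟩
    continuousOn_center := by
      have hspec : ∀ z : EuclideanSpace ℝ (Fin n) × ℝ, 0 ≤ z.2 ∧ closedBall z.1 z.2 ⊆
          ((unitBall n).openPartialHomeomorphSubtypeCoe ⟨⟨0, h0⟩⟩).target → ‖z.1‖ + z.2 < 1 :=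
        fun z hz => norm_add_lt_one hz.1 (hz.2.trans (Opens.openPartialHomeomorphSubtypeCoe_target _ _).subset)
      rw [IsInducing.subtypeVal.continuousOn_iff]
      have hcont : ContinuousOn (fun z : EuclideanSpace ℝ (Fin n) × ℝ =>
          centerRatio (‖z.1‖ ^ 2) z.2 • z.1) {z | 0 ≤ z.2 ∧ closedBall z.1 z.2 ⊆
          ((unitBall n).openPartialHomeomorphSubtypeCoe ⟨⟨0, h0⟩⟩).target} := by
        have hden : Continuous fun z : EuclideanSpace ℝ (Fin n) × ℝ =>
            (1 + ‖z.1‖ ^ 2 - z.2 ^ 2) + √((1 + ‖z.1‖ ^ 2 - z.2 ^ 2) ^ 2 - 4 * ‖z.1‖ ^ 2) := by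
          fun_prop
        refine ContinuousOn.smul (ContinuousOn.div continuousOn_const hden.continuousOn
          fun z hz => ?_) continuousOn_fst
        exact (centerRatio_spec (norm_nonneg z.1) hz.1 (hspec z hz)).1.ne'
      refine hcont.congr fun z hz => ?_
      have h1 := (centerRatio_spec (norm_nonneg z.1) hz.1 (hspec z hz)).2
      have h2 : centerRatio (‖z.1‖ ^ 2) z.2 • z.1 ∈ unitBall n := by
        refine mem_ball_zero_iff.2 ?_
        rw [norm_smul, Real.norm_of_nonneg (by linarith)]
        exact h1.2.1
      simp only [Function.comp_apply, dif_pos h2]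
    exists_image := by
      intro x r hr _
      -- In terms of `k = sinh (r / 2)` the ball is given by a quadratic inequality.
      obtain ⟨k, hk, rfl⟩ : ∃ k, 0 ≤ k ∧ r = 2 * Real.arsinh k :=
        ⟨Real.sinh (r / 2), Real.sinh_nonneg_iff.2 (by linarith), by rw [Real.arsinh_sinh]; ring⟩
      have hx := one_sub_norm_sq_pos x
      set m : ℝ := 1 + k ^ 2 * (1 - ‖(x : EuclideanSpace ℝ (Fin n))‖ ^ 2) with hm
      have hm1 : 0 ≤ k ^ 2 * (1 - ‖(x : EuclideanSpace ℝ (Fin n))‖ ^ 2) := by positivity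
      have hm0 : 0 < m := by linarith
      have hxm : 0 < m - ‖(x : EuclideanSpace ℝ (Fin n))‖ ^ 2 := by linarith
      have hs2 : (√((m - 1) * (m - ‖(x : EuclideanSpace ℝ (Fin n))‖ ^ 2)) / m) ^ 2 =
          (m - 1) * (m - ‖(x : EuclideanSpace ℝ (Fin n))‖ ^ 2) / m ^ 2 := by
        rw [div_pow, Real.sq_sqrt (mul_nonneg (by linarith) hxm.le)]
      have ha2 : ‖m⁻¹ • (x : EuclideanSpace ℝ (Fin n))‖ ^ 2 =
          ‖(x : EuclideanSpace ℝ (Fin n))‖ ^ 2 / m ^ 2 := by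
        rw [norm_smul, mul_pow, Real.norm_eq_abs, sq_abs, inv_pow, inv_mul_eq_div]
      refine ⟨m⁻¹ • (x : EuclideanSpace ℝ (Fin n)),
        √((m - 1) * (m - ‖(x : EuclideanSpace ℝ (Fin n))‖ ^ 2)) / m, by positivity, ?_, ?_, ?_⟩
      · intro hr
        have hk0 : 0 < k := Real.arsinh_pos_iff.1 (by linarith)
        have : 0 < m - 1 := by rw [hm, add_sub_cancel_left]; positivity
        positivity
      · refine hyperbolic_image_cball x hk (by positivity) hm (by rw [smul_inv_smul₀ hm0.ne']) ?_
        rw [hs2, ha2]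
        field_simp
      · have hratio : centerRatio (‖m⁻¹ • (x : EuclideanSpace ℝ (Fin n))‖ ^ 2)
            (√((m - 1) * (m - ‖(x : EuclideanSpace ℝ (Fin n))‖ ^ 2)) / m) = m := by
          have hN : 1 + ‖(x : EuclideanSpace ℝ (Fin n))‖ ^ 2 / m ^ 2 -
              (m - 1) * (m - ‖(x : EuclideanSpace ℝ (Fin n))‖ ^ 2) / m ^ 2 =
              (1 + ‖(x : EuclideanSpace ℝ (Fin n))‖ ^ 2) / m := by
            field_simp
            ring
          have hΔ : ((1 + ‖(x : EuclideanSpace ℝ (Fin n))‖ ^ 2) / m) ^ 2 -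
              4 * (‖(x : EuclideanSpace ℝ (Fin n))‖ ^ 2 / m ^ 2) =
              ((1 - ‖(x : EuclideanSpace ℝ (Fin n))‖ ^ 2) / m) ^ 2 := by
            field_simp
            ring
          rw [centerRatio, hs2, ha2, hN, hΔ, Real.sqrt_sq (by positivity)]
          field_simp
          ring
        have hmem : centerRatio (‖m⁻¹ • (x : EuclideanSpace ℝ (Fin n))‖ ^ 2)
            (√((m - 1) * (m - ‖(x : EuclideanSpace ℝ (Fin n))‖ ^ 2)) / m) •
              m⁻¹ • (x : EuclideanSpace ℝ (Fin n)) = x := by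
          rw [hratio, smul_inv_smul₀ hm0.ne']
        rw [dif_pos (by rw [hmem]; exact x.2)]
        exact Subtype.ext hmem
    exists_preimage := by
      intro a s hs has
      have hlt : ‖a‖ + s < 1 := norm_add_lt_one hs (has.trans (Opens.openPartialHomeomorphSubtypeCoe_target _ _).subset)
      obtain ⟨-, h1, h2, h3⟩ := centerRatio_spec (norm_nonneg a) hs hlt
      have hmem : centerRatio (‖a‖ ^ 2) s • a ∈ unitBall n := by
        refine mem_ball_zero_iff.2 ?_
        rw [norm_smul, Real.norm_of_nonneg (by linarith)]
        exact h2
      rw [dif_pos hmem]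
      set x : unitBall n := ⟨_, hmem⟩ with hx
      have hx0 := one_sub_norm_sq_pos x
      set k : ℝ := √((centerRatio (‖a‖ ^ 2) s - 1) /
        (1 - ‖(x : EuclideanSpace ℝ (Fin n))‖ ^ 2)) with hk
      refine ⟨2 * Real.arsinh k, by
        have := Real.arsinh_nonneg_iff.2 (Real.sqrt_nonneg _ : 0 ≤ k)
        positivity, by simp, ?_⟩
      refine hyperbolic_image_cball x (Real.sqrt_nonneg _) hs ?_ rfl h3
      rw [Real.sq_sqrt (div_nonneg (by linarith) hx0.le), div_mul_cancel₀ _ hx0.ne']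
      ring }

lemma hyperbolicChart_source [Nontrivial (EuclideanSpace ℝ (Fin n))] :
    (hyperbolicChart n).chart.source = univ := by
  simp [hyperbolicChart]

end Hyperbolic

end BallUnion

namespace BallUnion

open Metric Set Filter Topology CentralSet
open scoped RealInnerProductSpace

/-! ### The stereographic chart and the whole sphere -/

section Spherical

variable {N : ℕ} {v : EuclideanSpace ℝ (Fin (N + 1))}

lemma spherical_gdist_le_iff (x y : sphere (0 : EuclideanSpace ℝ (Fin (N + 1))) 1) {c : ℝ}
    (h1 : -1 ≤ c) (h2 : c ≤ 1) :
    GeodesicDist.gdist x y ≤ Real.arccos c ↔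
      c ≤ ⟪(x : EuclideanSpace ℝ (Fin (N + 1))), (y : EuclideanSpace ℝ (Fin (N + 1)))⟫ := by
  have hx : ‖(x : EuclideanSpace ℝ (Fin (N + 1)))‖ = 1 := norm_eq_of_mem_sphere x
  have hy : ‖(y : EuclideanSpace ℝ (Fin (N + 1)))‖ = 1 := norm_eq_of_mem_sphere y
  have habs := abs_le.1 (abs_real_inner_le_norm (x : EuclideanSpace ℝ (Fin (N + 1)))
    (y : EuclideanSpace ℝ (Fin (N + 1))))
  rw [hx, hy, one_mul] at habs
  simp only [GeodesicDist.gdist, InnerProductGeometry.angle]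
  rw [hx, hy, one_mul, div_one, Real.strictAntiOn_arccos.le_iff_ge habs ⟨h1, h2⟩]

/-- A vector in the direction of the spherical centre of the inverse stereographic image of the
ball with centre `a` and radius `s`. -/
noncomputable def axis (a : (ℝ ∙ v)ᗮ) (s : ℝ) : EuclideanSpace ℝ (Fin (N + 1)) :=
  (a : EuclideanSpace ℝ (Fin (N + 1))) + ((‖a‖ ^ 2 - s ^ 2) / 4 - 1) • v

lemma inner_left_eq_zero (a : (ℝ ∙ v)ᗮ) : ⟪(a : EuclideanSpace ℝ (Fin (N + 1))), v⟫ = 0 :=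
  Submodule.mem_orthogonal_singleton_iff_inner_left.1 a.2

lemma norm_axis_sq (hv : ‖v‖ = 1) (a : (ℝ ∙ v)ᗮ) (s : ℝ) :
    ‖axis a s‖ ^ 2 = ‖a‖ ^ 2 + ((‖a‖ ^ 2 - s ^ 2) / 4 - 1) ^ 2 := by
  rw [axis, norm_add_sq_real, inner_smul_right, inner_left_eq_zero, norm_smul, mul_pow, hv,
    Real.norm_eq_abs, sq_abs, Submodule.coe_norm]
  ring

lemma norm_axis_pos (hv : ‖v‖ = 1) (a : (ℝ ∙ v)ᗮ) (s : ℝ) : 0 < ‖axis a s‖ := by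
  refine (norm_nonneg _).lt_of_ne' fun h => ?_
  have h1 := norm_axis_sq hv a s
  rw [h] at h1
  have h2 : ‖a‖ ^ 2 = 0 := by nlinarith [sq_nonneg ‖a‖, sq_nonneg ((‖a‖ ^ 2 - s ^ 2) / 4 - 1)]
  rw [h2] at h1
  nlinarith [sq_nonneg s, sq_nonneg (s ^ 2)]

/-- The spherical centre of the inverse stereographic image of a ball. -/
noncomputable def sphericalCenter (hv : ‖v‖ = 1) (a : (ℝ ∙ v)ᗮ) (s : ℝ) :
    sphere (0 : EuclideanSpace ℝ (Fin (N + 1))) 1 :=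
  ⟨‖axis a s‖⁻¹ • axis a s, by
    rw [mem_sphere_zero_iff_norm, norm_smul, norm_inv, norm_norm,
      inv_mul_cancel₀ (norm_axis_pos hv a s).ne']⟩

lemma continuous_sphericalCenter (hv : ‖v‖ = 1) :
    Continuous fun z : (ℝ ∙ v)ᗮ × ℝ => sphericalCenter hv z.1 z.2 := by
  have h : Continuous fun z : (ℝ ∙ v)ᗮ × ℝ => axis z.1 z.2 := by
    unfold axis
    fun_prop
  exact ((h.norm.inv₀ fun z => (norm_axis_pos hv z.1 z.2).ne').smul h).subtype_mk _

/-- The cosine of the spherical radius of the inverse stereographic image of a ball. -/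
noncomputable def cosRadius (a : (ℝ ∙ v)ᗮ) (s : ℝ) : ℝ :=
  ((‖a‖ ^ 2 - s ^ 2) / 4 + 1) / ‖axis a s‖

lemma cosRadius_mem (hv : ‖v‖ = 1) (a : (ℝ ∙ v)ᗮ) (s : ℝ) :
    -1 ≤ cosRadius a s ∧ cosRadius a s ≤ 1 := by
  have hL := norm_axis_pos hv a s
  rw [← abs_le, cosRadius, abs_div, abs_of_pos hL, div_le_one hL]
  refine abs_le_of_sq_le_sq ?_ hL.le
  rw [norm_axis_sq hv]
  nlinarith [sq_nonneg s]

/-- Before normalisation the two sides differ by `2`; this keeps the cap away from the projection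
pole `v`. -/
lemma inner_pole_lt_cosRadius (hv : ‖v‖ = 1) (a : (ℝ ∙ v)ᗮ) (s : ℝ) :
    ⟪(sphericalCenter hv a s : EuclideanSpace ℝ (Fin (N + 1))), v⟫ < cosRadius a s := by
  have hL := norm_axis_pos hv a s
  rw [cosRadius, sphericalCenter, lt_div_iff₀ hL, inner_smul_left]
  simp only [conj_trivial]
  rw [mul_right_comm, inv_mul_cancel₀ hL.ne', axis, inner_add_left, inner_left_eq_zero,
    inner_smul_left, real_inner_self_eq_norm_sq, hv]
  simp only [conj_trivial]
  linarith

lemma cosRadius_le_inner_iff (hv : ‖v‖ = 1) (a w : (ℝ ∙ v)ᗮ) {s : ℝ} (hs : 0 ≤ s) :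
    cosRadius a s ≤ ⟪(sphericalCenter hv a s : EuclideanSpace ℝ (Fin (N + 1))),
      (stereoInvFun hv w : EuclideanSpace ℝ (Fin (N + 1)))⟫ ↔ w ∈ closedBall a s := by
  have hL := norm_axis_pos hv a s
  have hw : 0 < ‖w‖ ^ 2 + 4 := by positivity
  have hvw : ⟪v, (w : EuclideanSpace ℝ (Fin (N + 1)))⟫ = 0 :=
    Submodule.mem_orthogonal_singleton_iff_inner_right.1 w.2
  rw [mem_closedBall, dist_eq_norm, ← sq_le_sq₀ (norm_nonneg _) hs, norm_sub_sq_real,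
    cosRadius, sphericalCenter, stereoInvFun_apply, inner_smul_left, inner_smul_right]
  simp only [conj_trivial]
  rw [← div_eq_inv_mul, div_le_div_iff_of_pos_right hL, ← div_eq_inv_mul, le_div_iff₀ hw, axis,
    inner_add_left, inner_add_right, inner_add_right, inner_smul_left, inner_smul_left,
    inner_smul_right, inner_smul_right, inner_smul_right, inner_smul_right, inner_left_eq_zero,
    hvw, real_inner_self_eq_norm_sq, hv, real_inner_comm, Submodule.coe_inner]
  simp only [conj_trivial]
  constructor <;> intro <;> linarith

lemma cball_sphericalCenter_subset (hv : ‖v‖ = 1) (a : (ℝ ∙ v)ᗮ) (s : ℝ) :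
    cball (sphericalCenter hv a s) (Real.arccos (cosRadius a s)) ⊆
      (stereographic hv).source := by
  intro y hy
  rw [stereographic_source]
  rintro rfl
  have h := (spherical_gdist_le_iff _ _ (cosRadius_mem hv a s).1 (cosRadius_mem hv a s).2).1 hy
  exact h.not_gt (inner_pole_lt_cosRadius hv a s)

/-- Stereographic projection maps spherical balls to Euclidean balls. -/
lemma stereographic_image_cball (hv : ‖v‖ = 1) (a : (ℝ ∙ v)ᗮ) {s : ℝ} (hs : 0 ≤ s) :
    stereographic hv '' cball (sphericalCenter hv a s) (Real.arccos (cosRadius a s)) =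
      closedBall a s := by
  have hc := cosRadius_mem hv a s
  ext w
  rw [← cosRadius_le_inner_iff hv a w hs, ← spherical_gdist_le_iff _ _ hc.1 hc.2]
  constructor
  · rintro ⟨y, hy, rfl⟩
    have : stereoInvFun hv (stereographic hv y) = y :=
      (stereographic hv).left_inv (cball_sphericalCenter_subset hv a s hy)
    rwa [this]
  · intro h
    exact ⟨_, h, (stereographic hv).right_inv (mem_univ w)⟩

/-- Stereographic projection as a chart that preserves balls. -/
noncomputable def sphericalChart (hv : ‖v‖ = 1) :
    BallChart (sphere (0 : EuclideanSpace ℝ (Fin (N + 1))) 1) (ℝ ∙ v)ᗮ where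
  chart := stereographic hv
  center := sphericalCenter hv
  continuousOn_center := (continuous_sphericalCenter hv).continuousOn
  exists_image x r hr hxr := by
    have hx : ‖(x : EuclideanSpace ℝ (Fin (N + 1)))‖ = 1 := norm_eq_of_mem_sphere x
    -- The ball avoids the pole, so `cos r - β` is positive and can serve as denominator of the
    -- Euclidean centre and radius.
    have hangle : r < InnerProductGeometry.angle (x : EuclideanSpace ℝ (Fin (N + 1))) v := by
      by_contra! hc
      exact hxr (show (⟨v, by simp [hv]⟩ : sphere (0 : EuclideanSpace ℝ (Fin (N + 1))) 1) ∈
        cball x r from hc) rfl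
    have hrπ : r < Real.pi := hangle.trans_le (InnerProductGeometry.angle_le_pi _ _)
    set β : ℝ := ⟪(x : EuclideanSpace ℝ (Fin (N + 1))), v⟫ with hβ
    have hβc : β < Real.cos r := by
      have := Real.strictAntiOn_cos ⟨hr, hrπ.le⟩
        ⟨InnerProductGeometry.angle_nonneg _ _, InnerProductGeometry.angle_le_pi _ _⟩ hangle
      rwa [InnerProductGeometry.cos_angle, hx, hv, one_mul, div_one] at this
    set D : ℝ := Real.cos r - β with hD
    have hD0 : 0 < D := by linarith
    have hsin : 0 ≤ Real.sin r := Real.sin_nonneg_of_nonneg_of_le_pi hr hrπ.le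
    have hp : (x : EuclideanSpace ℝ (Fin (N + 1))) - β • v ∈ (ℝ ∙ v)ᗮ := by
      rw [Submodule.mem_orthogonal_singleton_iff_inner_left, inner_sub_left, inner_smul_left,
        real_inner_self_eq_norm_sq, hv]
      simp [hβ]
    set p : (ℝ ∙ v)ᗮ := ⟨_, hp⟩ with hpdef
    set a : (ℝ ∙ v)ᗮ := (2 / D) • p with ha
    set s : ℝ := 2 * Real.sin r / D with hs
    have hs0 : 0 ≤ s := by positivity
    have hpn : ‖p‖ ^ 2 = 1 - β ^ 2 := by
      rw [Submodule.coe_norm, hpdef, norm_sub_sq_real, inner_smul_right, ← hβ, norm_smul, mul_pow,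
        hx, hv, Real.norm_eq_abs, sq_abs]
      ring
    have hκ : (‖a‖ ^ 2 - s ^ 2) / 4 = (β + Real.cos r) / D := by
      rw [ha, norm_smul, mul_pow, hpn, Real.norm_eq_abs, sq_abs, hs, div_pow, div_pow, mul_pow,
        Real.sin_sq]
      field_simp
      rw [hD]
      ring
    have haxis : axis a s = (2 / D) • (x : EuclideanSpace ℝ (Fin (N + 1))) := by
      rw [axis, hκ, ha, Submodule.coe_smul, hpdef,
        show (β + Real.cos r) / D - 1 = (2 / D) * β by field_simp; rw [hD]; ring]
      module
    have hL : ‖axis a s‖ = 2 / D := by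
      rw [haxis, norm_smul, hx, mul_one, Real.norm_of_nonneg (by positivity)]
    have hcenter : sphericalCenter hv a s = x := by
      refine Subtype.ext ?_
      change ‖axis a s‖⁻¹ • axis a s = x
      rw [hL, haxis, inv_smul_smul₀ (by positivity)]
    have hcos : cosRadius a s = Real.cos r := by
      rw [cosRadius, hL, hκ]
      field_simp
      rw [hD]
      ring
    refine ⟨a, s, hs0, fun h => ?_, ?_, hcenter⟩
    · have := Real.sin_pos_of_pos_of_lt_pi h hrπ
      positivity
    · have := stereographic_image_cball hv a hs0
      rwa [hcenter, hcos, Real.arccos_cos hr hrπ.le] at this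
  exists_preimage a s hs _ :=
    ⟨_, Real.arccos_nonneg _, cball_sphericalCenter_subset hv a s, stereographic_image_cball hv a hs⟩

/-- The case in which the ball-polytope is the whole sphere. -/
lemma centralSet_maximalBallUnion_sphere (hN : 1 ≤ N)
    {X : Set (sphere (0 : EuclideanSpace ℝ (Fin (N + 1))) 1)}
    (hXne : X.Nonempty)
    (hZ : centralSet (maximalBallUnion univ (relBoundary (centralSet univ) X)) ⊆ X) :
    centralSet (maximalBallUnion univ X) = X := by
  have hball : ∀ x : sphere (0 : EuclideanSpace ℝ (Fin (N + 1))) 1,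
      cball x Real.pi = univ :=
    fun x => eq_univ_of_forall fun y => InnerProductGeometry.angle_le_pi _ _
  have hmax : ∀ x : sphere (0 : EuclideanSpace ℝ (Fin (N + 1))) 1,
      IsMaximalBall univ x Real.pi :=
    fun x => ⟨Real.pi_pos.le, subset_univ _, fun y s _ _ h => by
      rw [hball] at h
      exact h.not_subset (subset_univ _)⟩
  have hcentral : centralSet (univ : Set (sphere (0 : EuclideanSpace ℝ (Fin (N + 1))) 1)) =
      univ := eq_univ_of_forall fun x => ⟨_, hmax x⟩
  have hunion : ∀ Y : Set (sphere (0 : EuclideanSpace ℝ (Fin (N + 1))) 1), Y.Nonempty →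
      maximalBallUnion univ Y = univ := fun Y ⟨y, hy⟩ =>
    eq_univ_of_forall fun p => ⟨y, hy, _, hmax y, by rw [hball]; trivial⟩
  -- All points are central, and any single maximal ball is the whole sphere. Were `X` proper,
  -- connectedness would give a point of `Z`, so `U_Z` would be everything and the hypothesis would
  -- force `X` to be everything.
  have hXuniv : X = univ := by
    by_contra hne
    obtain ⟨y, hy⟩ := (ne_univ_iff_exists_notMem X).1 hne
    obtain ⟨x, hx⟩ := hXne
    have hrank : 1 < Module.rank ℝ (EuclideanSpace ℝ (Fin (N + 1))) := by
      rw [← Module.finrank_eq_rank, finrank_euclideanSpace_fin]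
      exact_mod_cast (by omega : 1 < N + 1)
    have hconn : IsPreconnected (univ : Set (sphere (0 : EuclideanSpace ℝ (Fin (N + 1))) 1)) := by
      rw [← IsInducing.subtypeVal.isPreconnected_image, image_univ, Subtype.range_coe]
      exact isPreconnected_sphere hrank 0 1
    obtain ⟨z, -, hz⟩ := exists_mem_relBoundary (C := centralSet univ) hcentral.symm.subset hconn
      (mem_univ x) (mem_univ y) hx hy
    rw [hunion _ ⟨z, hz⟩, hcentral] at hZ
    exact hy (hZ (mem_univ y))
  rw [hunion X hXne, hcentral, hXuniv]

end Spherical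

end BallUnion

/-! ### The three geometries -/

theorem mainTheorem8 (n : ℕ) (hn : 2 ≤ n) (g : Geom) (U X : Set (ModelSpace n g))
    (hU : CentralSet.IsBallPolytope n U)
    (hXC : X ⊆ CentralSet.centralSet U) (hXclosed : IsClosed X) (hXne : X.Nonempty)
    (hZ : CentralSet.centralSet (CentralSet.maximalBallUnion U
      (CentralSet.relBoundary (CentralSet.centralSet U) X)) ⊆ X) :
    CentralSet.centralSet (CentralSet.maximalBallUnion U X) = X := by
  obtain ⟨hballs, -⟩ := hU
  have : NeZero n := ⟨by omega⟩
  cases g with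
  | spherical =>
    change Set (Metric.sphere (0 : EuclideanSpace ℝ (Fin (n + 1))) 1) at U X
    by_cases hUuniv : U = Set.univ
    · subst hUuniv
      exact BallUnion.centralSet_maximalBallUnion_sphere (by omega) hXne hZ
    -- Projecting from a point outside `U` puts all of `U` in the domain of the chart.
    · obtain ⟨v, hvU⟩ := (Set.ne_univ_iff_exists_notMem U).1 hUuniv
      have hv : ‖(v : EuclideanSpace ℝ (Fin (n + 1)))‖ = 1 := norm_eq_of_mem_sphere v
      have hv0 : (v : EuclideanSpace ℝ (Fin (n + 1))) ≠ 0 := norm_ne_zero_iff.1 (by simp [hv])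
      have : Fact (Module.finrank ℝ (EuclideanSpace ℝ (Fin (n + 1))) = n + 1) :=
        ⟨finrank_euclideanSpace_fin⟩
      have : Nontrivial (Submodule.span ℝ {(v : EuclideanSpace ℝ (Fin (n + 1)))})ᗮ :=
        Module.nontrivial_of_finrank_pos (R := ℝ)
          (by rw [Submodule.finrank_orthogonal_span_singleton (n := n) hv0]; omega)
      refine BallUnion.centralSet_maximalBallUnion_of_chart (BallUnion.sphericalChart hv)
        (fun x hx h => hvU ?_) hballs hXC hXclosed hZ
      rw [Set.mem_singleton_iff.1 h] at hx
      exact hx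
  | euclidean =>
    exact BallUnion.centralSet_maximalBallUnion_of_chart (BallUnion.euclideanChart n)
      (Set.subset_univ _) hballs hXC hXclosed hZ
  | hyperbolic =>
    exact BallUnion.centralSet_maximalBallUnion_of_chart
      (M := unitBall n) (BallUnion.hyperbolicChart n)
      ((BallUnion.hyperbolicChart_source (n := n)).symm ▸ Set.subset_univ _) hballs hXC hXclosed hZ
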